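/- Let $\mathbb K$ be the field of absolutely convergent generalized real Puiseux series, i.e. of formal series $\boldsymbol z=\sum_{\alpha\in\mathbb R}c_\alpha t^\alpha$ with real coefficients $c_\alpha$ whose support $\{\alpha : c_\alpha\neq 0\}$ is either finite or has $-\infty$ as its unique accumulation point, and which converge absolutely for all sufficiently large real $t$, with sum $\boldsymbol z(t)$. For $\boldsymbol z\neq 0$ the valuation $\operatorname{val}\boldsymbol z$ is the greatest element of the support, and $\boldsymbol z>0$ means that the coefficient of $t^{\operatorname{val}\boldsymbol z}$ is positive. For a polyhedron $\mathcal P\subset\mathbb R^n$ let $f_{\mathcal P}(\theta)=\log\int_{\mathcal P}e^{\langle\theta,x\rangle}\,dx\in\mathbb R\cup\{\pm\infty\}$, and let the entropic barrier $f_{\mathcal P}^*(x)=\sup_{\theta\in\mathbb R^n}\bigl(\langle\theta,x\rangle-f_{\mathcal P}(\theta)\bigr)$ be its Fenchel conjugate. For $c\in\mathbb R^n$ and $\mu>0$, denote by $\mathcal C_{\mathcal P,c}(\mu)$ the unique minimizer of $\langle c,x\rangle+\mu f_{\mathcal P}^*(x)$ over $x\in\operatorname{int}\mathcal P$, whenever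 it exists (the point of parameter $\mu$ of the entropic central path). Let $r\ge 1$ be an integer and consider the parametric family of linear programs \[ \begin{array}{rl} \text{minimize} & x_1+t^{-1}x_2+\sum_{j=1}^{r-1}t^{-(j+1)}(x_{2j+1}+x_{2j+2})\\[2pt] \text{subject to} & x_1\le t^2,\quad x_2\le t,\\ & x_{2j+1}\le t\,x_{2j-1},\quad x_{2j+1}\le t\,x_{2j},\quad x_{2j+2}\le t^{1-1/2^j}(x_{2j-1}+x_{2j})\qquad(1\le j<r),\\ & x_{2r-1}\ge 0,\quad x_{2r}\ge 0, \end{array} \] which is defined by $3r+1$ inequalities in dimension $2r$. Let $\mathcal P(t)\subset\mathbb R^{2r}$ be its feasible set and $c(t)\in\mathbb R^{2r}$ its objective vector. Then there is a (unique) function $x:\mathbb R\to\mathbb R^{2r}$, the tropical entropic central path, such that for every $\mu\in\mathbb R$ and every $\boldsymbol\mu\in\mathbb K$ with $\boldsymbol\mu>0$ and $\operatorname{val}\boldsymbol\mu=\mu$, the point $\mathcal C_{\mathcal P(t),c(t)}(\boldsymbol\mu(t))$ exists for all sufficiently large $t$ and \[ \lim_{t\to+\infty}\log_t\,\mathcal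 C_{\mathcal P(t),c(t)}(\boldsymbol\mu(t))=x(\mu)\qquad\text{(entrywise, with }\log_t=\log/\log t). \] Restricted to $\mu\in[0,2]$, the map $x$ is piecewise linear with exactly $2^{r-1}$ linear pieces, i.e. $2^{r-1}$ is the least number of consecutive intervals into which $[0,2]$ can be subdivided so that $x$ is affine on each of them. -/

import Mathlib

open Filter Topology MeasureTheory

/-- Absolutely convergent generalized real Puiseux series `∑ c_α t^α` (`α ∈ ℝ`). The support is
finite or has `-∞` as its unique accumulation point in `[-∞, +∞]`, i.e. it meets every `[a, +∞)`
in a finite set, and the series converges absolutely for all sufficiently large real `t`. -/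
structure PuiseuxSeries where
  coeff : ℝ → ℝ
  finite_tail : ∀ a : ℝ, {α : ℝ | a ≤ α ∧ coeff α ≠ 0}.Finite
  summable : ∀ᶠ t : ℝ in atTop, Summable fun α : ℝ => |coeff α * t ^ α|

namespace PuiseuxSeries

/-- The value `z(t)` of the series at a (sufficiently large) real number `t`. -/
noncomputable def eval (z : PuiseuxSeries) (t : ℝ) : ℝ := ∑' α : ℝ, z.coeff α * t ^ α

/-- `z` is nonzero and has valuation `α`: the greatest exponent in its support is `α`. -/
def HasVal (z : PuiseuxSeries) (α : ℝ) : Prop := IsGreatest {β : ℝ | z.coeff β ≠ 0} α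

/-- `z > 0` in the ordered field of Puiseux series: the leading coefficient is positive. -/
def IsPos (z : PuiseuxSeries) : Prop := ∃ α : ℝ, z.HasVal α ∧ 0 < z.coeff α

open Classical in
/-- The monomial `a t^α`. -/
noncomputable def monomial (a α : ℝ) : PuiseuxSeries where
  coeff := fun β => if β = α then a else 0
  finite_tail := by
    intro x
    refine (Set.finite_singleton α).subset ?_
    rintro β ⟨-, hβ⟩
    by_contra h
    exact hβ (if_neg h)
  summable := by
    refine Eventually.of_forall fun t => ?_
    refine summable_of_ne_finset_zero (s := {α}) ?_
    intro β hβ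
    have h : β ≠ α := by simpa using hβ
    simp [h]

end PuiseuxSeries

/-- Logarithmic Laplace transform `θ ↦ log ∫_P e^{⟨θ, x⟩} dx` of the characteristic function
of `P`, with value `+∞` where the integral diverges. -/
noncomputable def logLaplace {κ : Type} [Fintype κ] (P : Set (κ → ℝ)) (θ : κ → ℝ) : EReal :=
  ENNReal.log (∫⁻ x in P, ENNReal.ofReal (Real.exp (θ ⬝ᵥ x)))

/-- The entropic barrier of `P`: the Fenchel conjugate of `logLaplace P`. -/
noncomputable def entropicBarrier {κ : Type} [Fintype κ] (P : Set (κ → ℝ)) (x : κ → ℝ) : EReal :=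
  ⨆ θ : κ → ℝ, ((θ ⬝ᵥ x : ℝ) : EReal) - logLaplace P θ

/-- The barrier objective `⟨c, x⟩ + μ φ(x)` with `φ` the entropic barrier of `P`. -/
noncomputable def barrierObjective {κ : Type} [Fintype κ] (P : Set (κ → ℝ)) (c : κ → ℝ) (μ : ℝ)
    (x : κ → ℝ) : EReal :=
  ((c ⬝ᵥ x : ℝ) : EReal) + (μ : EReal) * entropicBarrier P x

/-- `x` is the point of parameter `μ` of the entropic central path of the linear program
"minimize `⟨c, x⟩` subject to `x ∈ P`", that is, the unique optimal solution of the problem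
"minimize `⟨c, x⟩ + μ φ(x)` subject to `x ∈ interior P`". -/
def IsEntropicCentralPoint {κ : Type} [Fintype κ] (P : Set (κ → ℝ)) (c : κ → ℝ) (μ : ℝ)
    (x : κ → ℝ) : Prop :=
  x ∈ interior P ∧ IsMinOn (barrierObjective P c μ) (interior P) x ∧
    ∀ y ∈ interior P, IsMinOn (barrierObjective P c μ) (interior P) y → y = x

/-- A linear program "minimize `⟨c, x⟩` subject to `A x ≤ b`" over Puiseux series, with
inequalities indexed by `ι` and variables indexed by `κ`. -/
structure PuiseuxLP (ι κ : Type) where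
  A : Matrix ι κ PuiseuxSeries
  b : ι → PuiseuxSeries
  c : κ → PuiseuxSeries

namespace PuiseuxLP

/-- The real polyhedron `{x | A(t) x ≤ b(t)}`. -/
def polyhedron {ι κ : Type} [Fintype κ] (L : PuiseuxLP ι κ) (t : ℝ) : Set (κ → ℝ) :=
  {x | ∀ i : ι, ∑ k : κ, (L.A i k).eval t * x k ≤ (L.b i).eval t}

/-- The real objective vector `c(t)`. -/
noncomputable def cost {ι κ : Type} (L : PuiseuxLP ι κ) (t : ℝ) : κ → ℝ :=
  fun k => (L.c k).eval t

/-- `x` is the tropical entropic central path: for every real `μ` and every positive Puiseux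
series `m` of valuation `μ`, the point `C(t)` of parameter `m(t)` of the entropic central path of
the linear program at `t` exists for all large `t`, and `log_t C(t)` (entrywise) tends to `x μ`.
(Such an `x` is unique, as every `μ` is the valuation of the positive series `t^μ`.) -/
def IsTropicalEntropicCentralPath {ι κ : Type} [Fintype κ] (L : PuiseuxLP ι κ)
    (x : ℝ → κ → ℝ) : Prop :=
  ∀ (μ : ℝ) (m : PuiseuxSeries), m.IsPos → m.HasVal μ →
    ∃ C : ℝ → κ → ℝ,
      (∀ᶠ t in atTop, IsEntropicCentralPoint (L.polyhedron t) (L.cost t) (m.eval t) (C t)) ∧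
      Tendsto (fun t : ℝ => fun k : κ => Real.logb t (C t k)) atTop (𝓝 (x μ))

end PuiseuxLP

/-- `[a, b]` can be subdivided into `N` nondegenerate consecutive intervals on each of which `x`
is affine. -/
def AffineSubdivision {κ : Type} (x : ℝ → κ → ℝ) (a b : ℝ) (N : ℕ) : Prop :=
  ∃ p : Fin (N + 1) → ℝ, StrictMono p ∧ p 0 = a ∧ p (Fin.last N) = b ∧
    ∀ i : Fin N, ∃ u v : κ → ℝ, ∀ s ∈ Set.Icc (p i.castSucc) (p i.succ), x s = u + s • v

/-- On `[a, b]` the map `x` is piecewise linear with exactly `N` linear pieces: `N` is the least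
number of pieces of a subdivision of `[a, b]` into intervals on which `x` is affine. -/
def HasLinearPieces {κ : Type} (x : ℝ → κ → ℝ) (a b : ℝ) (N : ℕ) : Prop :=
  IsLeast {M : ℕ | AffineSubdivision x a b M} N

/-- Index set of the inequalities of the instance: the two inequalities bounding `x_1` and `x_2`,
three inequalities for each `1 ≤ j < r` (with `j` encoded by `j - 1 : Fin (r - 1)`), and the
nonnegativity of `x_{2r-1}` and `x_{2r}`. -/
abbrev LWIneq (r : ℕ) : Type := Fin 2 ⊕ (Fin (r - 1) × Fin 3) ⊕ Fin 2

/-- Coefficient of the variable `x_k` (numbered from `k = 1`) in the left-hand side of each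
inequality. In the middle block, `i` stands for `j = i + 1`. -/
noncomputable def lwCoeff (r : ℕ) : LWIneq r → ℕ → PuiseuxSeries
  -- `x_1 ≤ t^2`
  | .inl 0, k => if k = 1 then .monomial 1 0 else .monomial 0 0
  -- `x_2 ≤ t`
  | .inl 1, k => if k = 2 then .monomial 1 0 else .monomial 0 0
  -- `x_{2j+1} - t x_{2j-1} ≤ 0`
  | .inr (.inl (i, 0)), k =>
      if k = 2 * (i.val + 1) + 1 then .monomial 1 0
      else if k = 2 * i.val + 1 then .monomial (-1) 1
      else .monomial 0 0
  -- `x_{2j+1} - t x_{2j} ≤ 0`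
  | .inr (.inl (i, 1)), k =>
      if k = 2 * (i.val + 1) + 1 then .monomial 1 0
      else if k = 2 * (i.val + 1) then .monomial (-1) 1
      else .monomial 0 0
  -- `x_{2j+2} - t^{1-1/2^j} (x_{2j-1} + x_{2j}) ≤ 0`
  | .inr (.inl (i, 2)), k =>
      if k = 2 * (i.val + 1) + 2 then .monomial 1 0
      else if k = 2 * i.val + 1 ∨ k = 2 * (i.val + 1) then
        .monomial (-1) (1 - 1 / 2 ^ (i.val + 1))
      else .monomial 0 0
  -- `-x_{2r-1} ≤ 0`
  | .inr (.inr 0), k => if k + 1 = 2 * r then .monomial (-1) 0 else .monomial 0 0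
  -- `-x_{2r} ≤ 0`
  | .inr (.inr 1), k => if k = 2 * r then .monomial (-1) 0 else .monomial 0 0

/-- Right-hand sides of the inequalities: `t^2` and `t` for the first two, `0` for the others. -/
noncomputable def lwRhs (r : ℕ) : LWIneq r → PuiseuxSeries
  | .inl 0 => .monomial 1 2
  | .inl 1 => .monomial 1 1
  | .inr _ => .monomial 0 0

/-- Coefficient of `x_k` (numbered from `k = 1`) in the objective function
`x_1 + t^{-1} x_2 + ∑_{1 ≤ j < r} t^{-(j+1)} (x_{2j+1} + x_{2j+2})`. For `k ∈ {2j+1, 2j+2}` one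
has `(k - 1) / 2 = j` in `ℕ`. -/
noncomputable def lwCost (k : ℕ) : PuiseuxSeries :=
  if k = 1 then .monomial 1 0
  else if k = 2 then .monomial 1 (-1)
  else .monomial 1 (-((((k - 1) / 2 : ℕ) : ℝ) + 1))

/-- The parametric family of linear programs, in the variables `x_1, …, x_{2r}`; the variable
`x_k` has index `k - 1 : Fin (2 * r)`. -/
noncomputable def lwProgram (r : ℕ) : PuiseuxLP (LWIneq r) (Fin (2 * r)) where
  A := fun i k => lwCoeff r i (k.val + 1)
  b := lwRhs r
  c := fun k => lwCost (k.val + 1)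

/-! The entropic barrier is conjugate to the log-Laplace transform, so the central point of
parameter `m` is the mean of the Gibbs measure on `P` at `θ = -c / m`
(`isEntropicCentralPoint_gibbsMean`). The task is therefore to estimate the mean of an exponential
density on a compact convex set.

Two estimates with constants depending only on the dimension suffice. Where the energy `⟨c, x⟩ / m`
is nonnegative, each nonnegative coordinate of the mean dominates, up to a constant, that coordinate
of any feasible point of bounded energy (`le_gibbsMean`). If `0 ∈ P`, the mean itself has bounded
energy (`neg_dotProduct_gibbsMean_le`). Both come from contracting `P` by 1/2 towards one of its
points. So on the `log_t` scale the central point is the greatest feasible point of cost at most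
`m`. For this program that point is computed explicitly by `lwWitness`, whose recursion tropicalizes
to the min/max recursion `lwTropical`.

In the recursion, the difference `d_n` of the two coordinates of a pair satisfies `d_0 = μ - 1` on
`[0, 2]` and `d_{n+1} = 1 / 2^(n+1) - |d_n|`. Each step folds the graph, so `d_n` is a zigzag of
slopes `±1` on `2^n` equal cells. All pairs up to `n` are affine on these cells, and each interior
cell boundary is a genuine kink of the last pair, `n = r - 1`. -/

/-! ### Central points as means of Gibbs measures -/

section Gibbs

variable {κ : Type} [Fintype κ]

/-- The probability measure on `P` with density proportional to `exp ⟨θ, x⟩`. -/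
noncomputable def gibbs (P : Set (κ → ℝ)) (θ : κ → ℝ) : Measure (κ → ℝ) :=
  (volume.restrict P).tilted fun x => θ ⬝ᵥ x

/-- The mean of the measure `gibbs P θ`. -/
noncomputable def gibbsMean (P : Set (κ → ℝ)) (θ : κ → ℝ) : κ → ℝ :=
  fun k => ∫ x, x k ∂gibbs P θ

theorem continuous_exp_dotProduct (θ : κ → ℝ) :
    Continuous fun x : κ → ℝ => Real.exp (θ ⬝ᵥ x) := by
  unfold dotProduct
  fun_prop

theorem Continuous.integrable_restrict_of_isCompact {P : Set (κ → ℝ)} (hP : IsCompact P)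
    {g : (κ → ℝ) → ℝ} (hg : Continuous g) : Integrable g (volume.restrict P) :=
  hg.continuousOn.integrableOn_compact hP

variable {P : Set (κ → ℝ)}

theorem Continuous.integrable_gibbs (hP : IsCompact P)
    {g : (κ → ℝ) → ℝ} (hg : Continuous g) (θ : κ → ℝ) :
    Integrable g (gibbs P θ) := by
  rw [gibbs, integrable_tilted_iff
    ((continuous_exp_dotProduct θ).integrable_restrict_of_isCompact hP)]
  exact ((continuous_exp_dotProduct θ).smul hg).integrable_restrict_of_isCompact hP

theorem ae_gibbs_mem (hP : IsCompact P) (θ : κ → ℝ) : ∀ᵐ x ∂gibbs P θ, x ∈ P :=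
  (tilted_absolutelyContinuous _ _).ae_le (ae_restrict_mem hP.measurableSet)

theorem dotProduct_gibbsMean (hP : IsCompact P) (θ v : κ → ℝ) :
    v ⬝ᵥ gibbsMean P θ = ∫ x, v ⬝ᵥ x ∂gibbs P θ := by
  simp only [dotProduct, gibbsMean]
  rw [integral_finsetSum]
  · exact Finset.sum_congr rfl fun k _ => (integral_const_mul _ _).symm
  · intro k _
    exact Continuous.integrable_gibbs hP (by fun_prop) θ

theorem isProbabilityMeasure_gibbs (hP : IsCompact P) (hv : volume P ≠ 0)
    (θ : κ → ℝ) : IsProbabilityMeasure (gibbs P θ) := by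
  have : NeZero (volume.restrict P) := ⟨by rwa [Ne, Measure.restrict_eq_zero]⟩
  exact isProbabilityMeasure_tilted
    ((continuous_exp_dotProduct θ).integrable_restrict_of_isCompact hP)

theorem setIntegral_exp_dotProduct_pos (hP : IsCompact P) (hv : volume P ≠ 0)
    (θ : κ → ℝ) : 0 < ∫ x in P, Real.exp (θ ⬝ᵥ x) := by
  have : NeZero (volume.restrict P) := ⟨by rwa [Ne, Measure.restrict_eq_zero]⟩
  exact integral_exp_pos ((continuous_exp_dotProduct θ).integrable_restrict_of_isCompact hP)

theorem logLaplace_eq_log_setIntegral (hP : IsCompact P) (hv : volume P ≠ 0) (θ : κ → ℝ) :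
    logLaplace P θ = (Real.log (∫ x in P, Real.exp (θ ⬝ᵥ x)) : ℝ) := by
  rw [logLaplace, ← ofReal_integral_eq_lintegral_ofReal
    ((continuous_exp_dotProduct θ).integrable_restrict_of_isCompact hP)
    (Eventually.of_forall fun x => (Real.exp_pos _).le),
    ENNReal.log_ofReal_of_pos (setIntegral_exp_dotProduct_pos hP hv θ)]

theorem integral_gibbs_exp (hP : IsCompact P) (hv : volume P ≠ 0) (θ η : κ → ℝ) :
    ∫ x, Real.exp ((η - θ) ⬝ᵥ x) ∂gibbs P θ
      = Real.exp (Real.log (∫ x in P, Real.exp (η ⬝ᵥ x))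
          - Real.log (∫ x in P, Real.exp (θ ⬝ᵥ x))) := by
  rw [gibbs, integral_exp_tilted, Real.exp_sub,
    Real.exp_log (setIntegral_exp_dotProduct_pos hP hv η),
    Real.exp_log (setIntegral_exp_dotProduct_pos hP hv θ)]
  simp [sub_dotProduct]

/-- Jensen's inequality for `exp` under the Gibbs measure at `θ`. Consequently the supremum defining
the barrier at the mean is attained at `θ`. -/
theorem log_setIntegral_exp_ge (hP : IsCompact P) (hv : volume P ≠ 0) (θ η : κ → ℝ) :
    η ⬝ᵥ gibbsMean P θ - Real.log (∫ x in P, Real.exp (η ⬝ᵥ x))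
      ≤ θ ⬝ᵥ gibbsMean P θ - Real.log (∫ x in P, Real.exp (θ ⬝ᵥ x)) := by
  have := isProbabilityMeasure_gibbs hP hv θ
  have hc : Continuous fun x : κ → ℝ => (η - θ) ⬝ᵥ x := by unfold dotProduct; fun_prop
  have h := convexOn_exp.map_integral_le (μ := gibbs P θ) (f := fun x => (η - θ) ⬝ᵥ x)
    Real.continuous_exp.continuousOn isClosed_univ (by simp) (hc.integrable_gibbs hP θ)
    ((Real.continuous_exp.comp hc).integrable_gibbs hP θ)
  rw [integral_gibbs_exp hP hv, Real.exp_le_exp, ← dotProduct_gibbsMean hP, sub_dotProduct] at h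
  linarith

/-- A point at which the Fenchel–Young inequality is an equality is the Gibbs mean. -/
theorem eq_gibbsMean_of_forall_le (hP : IsCompact P) (hv : volume P ≠ 0) (θ y : κ → ℝ)
    (hy : ∀ η : κ → ℝ, η ⬝ᵥ y - Real.log (∫ x in P, Real.exp (η ⬝ᵥ x))
      ≤ θ ⬝ᵥ y - Real.log (∫ x in P, Real.exp (θ ⬝ᵥ x))) : y = gibbsMean P θ := by
  classical
  have := isProbabilityMeasure_gibbs hP hv θ
  ext k
  have hc : Continuous fun x : κ → ℝ => x k - y k := by fun_prop
  obtain ⟨M, hM⟩ := hP.exists_bound_of_continuousOn hc.continuousOn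
  -- Test optimality of `θ` against `θ + s e_k` and expand to second order with `exp u ≤ 1 + u + u²`
  -- for `|u| ≤ 1`. The first-order term must vanish.
  have key : ∀ s : ℝ, |s| * (|M| + 1) ≤ 1 →
      0 ≤ s * (gibbsMean P θ k - y k) + s ^ 2 * (|M| + 1) ^ 2 := by
    intro s hs
    have h1 : 1 ≤ ∫ x, Real.exp (s * (x k - y k)) ∂gibbs P θ := by
      have h2 := integral_gibbs_exp hP hv θ (θ + s • Pi.single k 1)
      have h3 := hy (θ + s • Pi.single k 1)
      have h4 : ∀ x : κ → ℝ, Real.exp (s * (x k - y k))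
          = Real.exp ((θ + s • Pi.single k 1 - θ) ⬝ᵥ x) * Real.exp (-(s * y k)) := by
        intro x
        rw [← Real.exp_add]
        simp
        ring
      simp_rw [h4]
      rw [integral_mul_const, h2, ← Real.exp_add, Real.one_le_exp_iff]
      rw [add_dotProduct] at h3
      simp only [smul_dotProduct, single_dotProduct, one_mul, smul_eq_mul] at h3
      linarith
    have h5 : ∫ x, Real.exp (s * (x k - y k)) ∂gibbs P θ
        ≤ ∫ x, (1 + s * (x k - y k) + s ^ 2 * (|M| + 1) ^ 2) ∂gibbs P θ := by
      refine integral_mono_ae (Continuous.integrable_gibbs hP (by fun_prop) θ)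
        (Continuous.integrable_gibbs hP (by fun_prop) θ) ?_
      filter_upwards [ae_gibbs_mem hP θ] with x hx
      have hb : |x k - y k| ≤ |M| + 1 := by
        have := hM x hx
        rw [Real.norm_eq_abs] at this
        linarith [le_abs_self M]
      have hsx : |s * (x k - y k)| ≤ 1 := by
        rw [abs_mul]
        exact (mul_le_mul_of_nonneg_left hb (abs_nonneg s)).trans hs
      have h6 := (abs_le.1 (Real.abs_exp_sub_one_sub_id_le hsx)).2
      have h7 : (s * (x k - y k)) ^ 2 ≤ s ^ 2 * (|M| + 1) ^ 2 := by
        rw [mul_pow]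
        exact mul_le_mul_of_nonneg_left (sq_le_sq' (by linarith [(abs_le.1 hb).1])
          (abs_le.1 hb).2) (sq_nonneg s)
      linarith
    have h8 : ∫ x, (1 + s * (x k - y k) + s ^ 2 * (|M| + 1) ^ 2) ∂gibbs P θ
        = 1 + s * (gibbsMean P θ k - y k) + s ^ 2 * (|M| + 1) ^ 2 := by
      rw [integral_add (Continuous.integrable_gibbs hP (by fun_prop) θ) (integrable_const _),
        integral_add (integrable_const _) (Continuous.integrable_gibbs hP (by fun_prop) θ),
        integral_const_mul, integral_sub (Continuous.integrable_gibbs hP (by fun_prop) θ)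
        (integrable_const _)]
      simp [gibbsMean]
    linarith
  set D := gibbsMean P θ k - y k with hD
  set B := |M| + 1 with hB
  have hB1 : 1 ≤ B := by linarith [abs_nonneg M]
  have hDB : D = 0 := by
    by_contra h0
    have habs : 0 < |D| := abs_pos.2 h0
    -- The sign of `s` is opposite to that of `D`, and `s` is small enough that `|s| B ≤ 1` and the
    -- linear term beats the quadratic one.
    set s := -D / (2 * B ^ 2 * (1 + |D|)) with hs
    have hden : 0 < 2 * B ^ 2 * (1 + |D|) := by positivity
    have h1 : |s| * B ≤ 1 := by
      rw [hs, abs_div, abs_neg, abs_of_pos hden, div_mul_eq_mul_div, div_le_one hden]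
      nlinarith [mul_nonneg habs.le (by positivity : 0 ≤ B), sq_nonneg B]
    have h2 := key s h1
    have h3 : s * D + s ^ 2 * B ^ 2
        = - (D ^ 2 / (2 * B ^ 2 * (1 + |D|))) * (1 - 1 / (2 * (1 + |D|))) := by
      rw [hs]; field_simp
      ring
    have h4 : 0 < D ^ 2 / (2 * B ^ 2 * (1 + |D|)) := by positivity
    have h5 : 0 < 1 - 1 / (2 * (1 + |D|)) := by
      rw [sub_pos, div_lt_one (by positivity)]
      linarith
    rw [h3] at h2
    nlinarith [mul_pos h4 h5]
  linarith

/-- The mean of the Gibbs measure at `-c / μ` is the point of parameter `μ` of the entropic central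
path, as soon as it is an interior point. -/
theorem isEntropicCentralPoint_gibbsMean (hP : IsCompact P) (hv : volume P ≠ 0)
    (c : κ → ℝ) {μ : ℝ} (hμ : 0 < μ)
    (hmem : gibbsMean P (-μ⁻¹ • c) ∈ interior P) :
    IsEntropicCentralPoint P c μ (gibbsMean P (-μ⁻¹ • c)) := by
  set θ := -μ⁻¹ • c with hθ
  set F : (κ → ℝ) → ℝ := fun η => Real.log (∫ x in P, Real.exp (η ⬝ᵥ x)) with hF
  have hc : ∀ x : κ → ℝ, μ * (θ ⬝ᵥ x) = -(c ⬝ᵥ x) := by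
    intro x
    rw [hθ, smul_dotProduct, smul_eq_mul]
    field_simp
  have hbar : ∀ x, entropicBarrier P x = ⨆ η : κ → ℝ, ((η ⬝ᵥ x - F η : ℝ) : EReal) := by
    intro x
    simp only [entropicBarrier, logLaplace_eq_log_setIntegral hP hv, EReal.coe_sub, hF]
  have hmean : entropicBarrier P (gibbsMean P θ)
      = ((θ ⬝ᵥ gibbsMean P θ - F θ : ℝ) : EReal) := by
    rw [hbar]
    refine le_antisymm (iSup_le fun η => ?_)
      (le_iSup (fun η : κ → ℝ => ((η ⬝ᵥ gibbsMean P θ - F η : ℝ) : EReal)) θ)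
    exact EReal.coe_le_coe_iff.2 (log_setIntegral_exp_ge hP hv θ η)
  -- Since `μ θ = -c`, the cost cancels the linear part of the barrier.
  have hval : barrierObjective P c μ (gibbsMean P θ) = ((-(μ * F θ) : ℝ) : EReal) := by
    rw [barrierObjective, hmean, ← EReal.coe_mul, ← EReal.coe_add, mul_sub, hc]
    congr 1
    ring
  have hge : ∀ x, ((θ ⬝ᵥ x - F θ : ℝ) : EReal) ≤ entropicBarrier P x := by
    intro x
    rw [hbar]
    exact le_iSup (fun η : κ → ℝ => ((η ⬝ᵥ x - F η : ℝ) : EReal)) θ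
  have hμ0 : (0 : EReal) < (μ : EReal) := EReal.coe_pos.2 hμ
  refine ⟨hmem, ?_, ?_⟩
  · intro x _
    rw [Set.mem_ofPred_eq, hval, barrierObjective]
    have h1 : (μ : EReal) * ((θ ⬝ᵥ x - F θ : ℝ) : EReal) ≤ μ * entropicBarrier P x :=
      mul_le_mul_of_nonneg_left (hge x) hμ0.le
    refine le_trans (le_of_eq ?_) (add_le_add_right h1 _)
    rw [← EReal.coe_mul, ← EReal.coe_add, mul_sub, hc]
    congr 1
    ring
  -- Comparing the value at another minimizer `y` with the optimal one shows that `θ` also attains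
  -- the supremum at `y`, which characterizes the mean.
  · intro y _ hy
    have h1 : barrierObjective P c μ y ≤ ((-(μ * F θ) : ℝ) : EReal) := hval ▸ hy hmem
    refine eq_gibbsMean_of_forall_le hP hv θ y fun η => ?_
    have h2 : ((η ⬝ᵥ y - F η : ℝ) : EReal) ≤ entropicBarrier P y := by
      rw [hbar]
      exact le_iSup (fun η : κ → ℝ => ((η ⬝ᵥ y - F η : ℝ) : EReal)) η
    have h3 : (μ : EReal) * ((η ⬝ᵥ y - F η : ℝ) : EReal) ≤ μ * entropicBarrier P y :=
      mul_le_mul_of_nonneg_left h2 hμ0.le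
    have h4 := (add_le_add_right h3 ((c ⬝ᵥ y : ℝ) : EReal)).trans h1
    rw [← EReal.coe_mul, ← EReal.coe_add, EReal.coe_le_coe_iff] at h4
    have h5 : μ * (η ⬝ᵥ y - F η) ≤ μ * (θ ⬝ᵥ y - F θ) := by
      rw [mul_sub μ (θ ⬝ᵥ y), hc]
      linarith
    exact le_of_mul_le_mul_left h5 hμ

end Gibbs

/-! ### Dimension-only estimates on Gibbs means -/

section GibbsBounds

variable {κ : Type} [Fintype κ] {P : Set (κ → ℝ)}

theorem integral_gibbs_eq_div (θ : κ → ℝ) (g : (κ → ℝ) → ℝ) :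
    ∫ x, g x ∂gibbs P θ
      = (∫ x in P, Real.exp (θ ⬝ᵥ x) * g x) / ∫ x in P, Real.exp (θ ⬝ᵥ x) := by
  rw [gibbs, integral_tilted, ← integral_div]
  refine integral_congr_ae (Eventually.of_forall fun x => ?_)
  simp only [smul_eq_mul]
  ring

/-- Change of variables under the homothety `x ↦ (x + y) / 2`. -/
theorem integral_comp_midpoint (g : (κ → ℝ) → ℝ) (y : κ → ℝ) :
    ∫ x, g ((2⁻¹ : ℝ) • (x + y)) = 2 ^ Fintype.card κ * ∫ x, g x := by
  rw [integral_add_right_eq_self (fun x => g ((2⁻¹ : ℝ) • x)) y,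
    Measure.integral_comp_smul_of_nonneg volume g 2⁻¹ (hR := by norm_num)]
  simp

theorem integrable_comp_midpoint {g : (κ → ℝ) → ℝ} (hg : Integrable g) (y : κ → ℝ) :
    Integrable fun x => g ((2⁻¹ : ℝ) • (x + y)) :=
  (hg.comp_smul (R := (2⁻¹ : ℝ)) (by norm_num)).comp_add_right y

/-- If `h x ≤ g ((x + y) / 2)` on the convex set `P`, then `∫_P h ≤ 2 ^ n ∫_P g`. -/
theorem setIntegral_le_of_le_comp_midpoint (hP : IsCompact P) (hconv : Convex ℝ P)
    {g h : (κ → ℝ) → ℝ} (hg : Continuous g) (hh : Continuous h) (hg0 : ∀ x ∈ P, 0 ≤ g x)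
    {y : κ → ℝ} (hy : y ∈ P) (hle : ∀ x ∈ P, h x ≤ g ((2⁻¹ : ℝ) • (x + y))) :
    ∫ x in P, h x ≤ 2 ^ Fintype.card κ * ∫ x in P, g x := by
  rw [← integral_indicator hP.measurableSet, ← integral_indicator hP.measurableSet,
    ← integral_comp_midpoint _ y]
  have hgi : Integrable (P.indicator g) :=
    (integrable_indicator_iff hP.measurableSet).2 (hg.continuousOn.integrableOn_compact hP)
  refine integral_mono ((integrable_indicator_iff hP.measurableSet).2
    (hh.continuousOn.integrableOn_compact hP)) (integrable_comp_midpoint hgi y) fun x => ?_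
  by_cases hx : x ∈ P
  · have hm : (2⁻¹ : ℝ) • (x + y) ∈ P := by
      rw [smul_add]
      exact hconv hx hy (by norm_num) (by norm_num) (by norm_num)
    simp only [Set.indicator_of_mem hx, Set.indicator_of_mem hm]
    exact hle x hx
  · simp only [Set.indicator_of_notMem hx]
    exact Set.indicator_nonneg hg0 _

/-- The Gibbs mean of a coordinate which is nonnegative on `P` is, up to a constant, at least the
value of this coordinate at any point of `P` of bounded energy. -/
theorem le_gibbsMean (hP : IsCompact P) (hv : volume P ≠ 0) (hconv : Convex ℝ P)
    {θ : κ → ℝ} (hθ : ∀ x ∈ P, θ ⬝ᵥ x ≤ 0) {y : κ → ℝ} (hy : y ∈ P) {K : ℝ}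
    (hK : -K ≤ θ ⬝ᵥ y) (k : κ) (hk : ∀ x ∈ P, 0 ≤ x k) :
    (2 ^ (Fintype.card κ + 1))⁻¹ * Real.exp (-(K / 2)) * y k ≤ gibbsMean P θ k := by
  have hZ := setIntegral_exp_dotProduct_pos hP hv θ
  rw [gibbsMean, integral_gibbs_eq_div, le_div_iff₀ hZ]
  have hc := continuous_exp_dotProduct θ
  -- At the midpoint of `x` and `y` the exponent is at least `⟨θ, x⟩ - K / 2`, because `⟨θ, x⟩ ≤ 0`,
  -- and the `k`-th coordinate is at least `y k / 2`.
  have h := setIntegral_le_of_le_comp_midpoint hP hconv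
    (g := fun x => Real.exp (θ ⬝ᵥ x) * x k)
    (h := fun x => (Real.exp (-(K / 2)) * (y k / 2)) * Real.exp (θ ⬝ᵥ x))
    (by fun_prop) (by fun_prop) (fun x hx => mul_nonneg (Real.exp_pos _).le (hk x hx)) hy ?_
  · rw [integral_const_mul] at h
    rw [pow_succ, mul_inv, mul_assoc, mul_assoc, mul_assoc, inv_mul_le_iff₀ (by positivity)]
    refine le_trans (le_of_eq ?_) h
    ring
  · intro x hx
    simp only [dotProduct_smul, dotProduct_add, Pi.smul_apply, Pi.add_apply, smul_eq_mul]
    have h1 : Real.exp (-(K / 2)) * Real.exp (θ ⬝ᵥ x)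
        ≤ Real.exp (2⁻¹ * (θ ⬝ᵥ x + θ ⬝ᵥ y)) := by
      rw [← Real.exp_add, Real.exp_le_exp]
      linarith [hθ x hx]
    have h2 : y k / 2 ≤ 2⁻¹ * (x k + y k) := by linarith [hk x hx]
    calc Real.exp (-(K / 2)) * (y k / 2) * Real.exp (θ ⬝ᵥ x)
        = Real.exp (-(K / 2)) * Real.exp (θ ⬝ᵥ x) * (y k / 2) := by ring
      _ ≤ _ := mul_le_mul h1 h2 (by linarith [hk y hy]) (Real.exp_pos _).le

/-- The mean energy of the Gibbs measure is bounded by a constant. -/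
theorem neg_dotProduct_gibbsMean_le (hP : IsCompact P) (hv : volume P ≠ 0) (hconv : Convex ℝ P)
    (h0 : (0 : κ → ℝ) ∈ P) (θ : κ → ℝ) :
    -(θ ⬝ᵥ gibbsMean P θ) ≤ 2 ^ (Fintype.card κ + 1) := by
  have hZ := setIntegral_exp_dotProduct_pos hP hv θ
  have hc := continuous_exp_dotProduct θ
  have hd : Continuous fun x : κ → ℝ => θ ⬝ᵥ x := by unfold dotProduct; fun_prop
  rw [dotProduct_gibbsMean hP, integral_gibbs_eq_div, ← neg_div, div_le_iff₀ hZ, ← integral_neg]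
  -- Contract towards `0`: with `u = -⟨θ, x⟩`, the inequality `u / 2 ≤ exp (u / 2)` gives `u exp
  -- (-u) / 2 ≤ exp (-u / 2)`.
  have h := setIntegral_le_of_le_comp_midpoint hP hconv
    (g := fun x => Real.exp (θ ⬝ᵥ x))
    (h := fun x => -(Real.exp (θ ⬝ᵥ x) * (θ ⬝ᵥ x)) / 2)
    hc (by fun_prop) (fun x hx => (Real.exp_pos _).le) h0 ?_
  · rw [integral_div] at h
    rw [pow_succ]
    linarith
  · intro x hx
    simp only [dotProduct_smul, add_zero, smul_eq_mul]
    have h1 : Real.exp (θ ⬝ᵥ x)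
        = Real.exp (2⁻¹ * (θ ⬝ᵥ x)) * Real.exp (2⁻¹ * (θ ⬝ᵥ x)) := by
      rw [← Real.exp_add]; congr 1; ring
    have h2 : -(θ ⬝ᵥ x) / 2 ≤ Real.exp (-(2⁻¹ * (θ ⬝ᵥ x))) := by
      linarith [Real.add_one_le_exp (-(2⁻¹ * (θ ⬝ᵥ x)))]
    have h3 : Real.exp (2⁻¹ * (θ ⬝ᵥ x)) * Real.exp (-(2⁻¹ * (θ ⬝ᵥ x))) = 1 := by
      rw [← Real.exp_add]; simp
    have hpos := Real.exp_pos (2⁻¹ * (θ ⬝ᵥ x))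
    calc -(Real.exp (θ ⬝ᵥ x) * (θ ⬝ᵥ x)) / 2
        = Real.exp (2⁻¹ * (θ ⬝ᵥ x)) * (Real.exp (2⁻¹ * (θ ⬝ᵥ x)) * (-(θ ⬝ᵥ x) / 2)) := by
          rw [h1]; ring
      _ ≤ Real.exp (2⁻¹ * (θ ⬝ᵥ x)) * (Real.exp (2⁻¹ * (θ ⬝ᵥ x))
            * Real.exp (-(2⁻¹ * (θ ⬝ᵥ x)))) := by gcongr
      _ = Real.exp (2⁻¹ * (θ ⬝ᵥ x)) := by rw [h3, mul_one]

end GibbsBounds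

/-! ### Polyhedra with a strictly feasible point -/

section Polyhedra

variable {ι κ : Type} [Fintype κ]

theorem isClosed_setOf_forall_dotProduct_le (A : ι → κ → ℝ) (b : ι → ℝ) :
    IsClosed {x : κ → ℝ | ∀ i, A i ⬝ᵥ x ≤ b i} := by
  rw [show {x : κ → ℝ | ∀ i, A i ⬝ᵥ x ≤ b i} = ⋂ i, {x | A i ⬝ᵥ x ≤ b i} by
    ext; simp]
  refine isClosed_iInter fun i => isClosed_le ?_ continuous_const
  unfold dotProduct
  fun_prop

theorem convex_setOf_forall_dotProduct_le (A : ι → κ → ℝ) (b : ι → ℝ) :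
    Convex ℝ {x : κ → ℝ | ∀ i, A i ⬝ᵥ x ≤ b i} := by
  intro x hx y hy a a' ha ha' h i
  rw [dotProduct_add, dotProduct_smul, dotProduct_smul, smul_eq_mul, smul_eq_mul]
  calc a * (A i ⬝ᵥ x) + a' * (A i ⬝ᵥ y) ≤ a * b i + a' * b i :=
        add_le_add (mul_le_mul_of_nonneg_left (hx i) ha) (mul_le_mul_of_nonneg_left (hy i) ha')
    _ = b i := by rw [← add_mul, h, one_mul]

variable [Finite ι]

theorem isOpen_setOf_forall_dotProduct_lt (A : ι → κ → ℝ) (b : ι → ℝ) :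
    IsOpen {x : κ → ℝ | ∀ i, A i ⬝ᵥ x < b i} := by
  rw [show {x : κ → ℝ | ∀ i, A i ⬝ᵥ x < b i} = ⋂ i, {x | A i ⬝ᵥ x < b i} by
    ext; simp]
  refine isOpen_iInter_of_finite fun i => isOpen_lt ?_ continuous_const
  unfold dotProduct
  fun_prop

theorem setOf_forall_dotProduct_lt_subset_interior (A : ι → κ → ℝ) (b : ι → ℝ) :
    {x : κ → ℝ | ∀ i, A i ⬝ᵥ x < b i} ⊆ interior {x : κ → ℝ | ∀ i, A i ⬝ᵥ x ≤ b i} :=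
  interior_maximal (fun _ hx i => (hx i).le) (isOpen_setOf_forall_dotProduct_lt A b)

variable {A : ι → κ → ℝ} {b : ι → ℝ} {y : κ → ℝ}

theorem volume_setOf_forall_dotProduct_lt_ne_zero (hy : ∀ i, A i ⬝ᵥ y < b i) :
    volume {x : κ → ℝ | ∀ i, A i ⬝ᵥ x < b i} ≠ 0 :=
  ((isOpen_setOf_forall_dotProduct_lt A b).measure_pos volume ⟨y, hy⟩).ne'

theorem volume_setOf_forall_dotProduct_le_ne_zero (hy : ∀ i, A i ⬝ᵥ y < b i) :
    volume {x : κ → ℝ | ∀ i, A i ⬝ᵥ x ≤ b i} ≠ 0 := fun h =>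
  volume_setOf_forall_dotProduct_lt_ne_zero hy (measure_mono_null (fun _ hx i => (hx i).le) h)

/-- The Gibbs mean of a bounded polyhedron with a strictly feasible point is strictly feasible. -/
theorem gibbsMean_mem_interior (hy : ∀ i, A i ⬝ᵥ y < b i)
    (hP : IsCompact {x : κ → ℝ | ∀ i, A i ⬝ᵥ x ≤ b i}) (θ : κ → ℝ) :
    gibbsMean {x : κ → ℝ | ∀ i, A i ⬝ᵥ x ≤ b i} θ
      ∈ interior {x : κ → ℝ | ∀ i, A i ⬝ᵥ x ≤ b i} := by
  set P := {x : κ → ℝ | ∀ i, A i ⬝ᵥ x ≤ b i} with hPdef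
  have hv : volume P ≠ 0 := volume_setOf_forall_dotProduct_le_ne_zero hy
  have := isProbabilityMeasure_gibbs hP hv θ
  refine setOf_forall_dotProduct_lt_subset_interior A b fun i => ?_
  have hd : Continuous fun x : κ → ℝ => A i ⬝ᵥ x := by unfold dotProduct; fun_prop
  -- The slack is nonnegative on `P` and positive on the strictly feasible set, which is open and
  -- nonempty and so has positive Gibbs mass.
  have hpos : 0 < ∫ x, (b i - A i ⬝ᵥ x) ∂gibbs P θ := by
    rw [integral_pos_iff_support_of_nonneg_ae]
    · refine lt_of_lt_of_le ?_ (measure_mono (s := {x : κ → ℝ | ∀ i, A i ⬝ᵥ x < b i})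
        fun x hx => (sub_pos.2 (hx i)).ne')
      refine pos_iff_ne_zero.2 fun h0 => ?_
      have h1 := absolutelyContinuous_tilted (μ := volume.restrict P)
        ((continuous_exp_dotProduct θ).integrable_restrict_of_isCompact hP) h0
      rw [Measure.restrict_apply (isOpen_setOf_forall_dotProduct_lt A b).measurableSet,
        Set.inter_eq_left.2 fun x hx i => (hx i).le] at h1
      exact volume_setOf_forall_dotProduct_lt_ne_zero hy h1
    · filter_upwards [ae_gibbs_mem hP θ] with x hx
      exact sub_nonneg.2 (hx i)
    · exact Continuous.integrable_gibbs hP (by fun_prop) θ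
  rw [integral_sub (integrable_const _) (hd.integrable_gibbs hP θ),
    ← dotProduct_gibbsMean hP] at hpos
  simpa using hpos

end Polyhedra

/-! ### Asymptotics of Puiseux series and the `log_t` scale -/

namespace PuiseuxSeries

theorem eval_monomial (a α t : ℝ) : (monomial a α).eval t = a * t ^ α := by
  rw [eval, tsum_eq_single α]
  · simp [monomial]
  · intro β hβ
    simp [monomial, hβ]

/-- Dominated convergence for series: after division by `t ^ μ` all exponents are nonpositive, so
for `t ≥ T` the terms are dominated by their values at one point `T` of absolute convergence. -/
theorem tendsto_eval_div_rpow {z : PuiseuxSeries} {μ : ℝ} (hz : z.HasVal μ) :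
    Tendsto (fun t => z.eval t / t ^ μ) atTop (𝓝 (z.coeff μ)) := by
  classical
  obtain ⟨T, hT, hT1⟩ := (z.summable.and (eventually_ge_atTop (1 : ℝ))).exists
  have hT0 : 0 < T := by linarith
  have hle : ∀ α, z.coeff α ≠ 0 → α ≤ μ := fun α hα => hz.2 hα
  have h := tendsto_tsum_of_dominated_convergence (𝓕 := atTop)
    (f := fun (t : ℝ) (α : ℝ) => z.coeff α * t ^ (α - μ))
    (g := fun α => if α = μ then z.coeff μ else 0)
    (bound := fun α => |z.coeff α * T ^ α| / T ^ μ) (hT.div_const _) ?_ ?_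
  · rw [tsum_ite_eq] at h
    refine h.congr' ?_
    filter_upwards [eventually_gt_atTop 0] with t ht
    rw [eval, ← tsum_div_const]
    refine tsum_congr fun α => ?_
    rw [Real.rpow_sub ht, mul_div_assoc]
  · intro α
    by_cases hα : α = μ
    · simp [hα]
    · simp only [hα, if_false]
      by_cases hc : z.coeff α = 0
      · simp [hc]
      · have hlt : 0 < μ - α := sub_pos.2 (lt_of_le_of_ne (hle α hc) hα)
        have := (tendsto_rpow_neg_atTop hlt).const_mul (z.coeff α)
        simpa using this
  · filter_upwards [eventually_ge_atTop T] with t ht α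
    by_cases hc : z.coeff α = 0
    · simp [hc]
    · have ht0 : 0 < t := hT0.trans_le ht
      rw [Real.norm_eq_abs, abs_mul, abs_mul, mul_div_assoc, abs_of_pos (Real.rpow_pos_of_pos ht0 _),
        abs_of_pos (Real.rpow_pos_of_pos hT0 _), ← Real.rpow_sub hT0]
      exact mul_le_mul_of_nonneg_left
        (Real.rpow_le_rpow_of_nonpos hT0 ht (by linarith [hle α hc])) (abs_nonneg _)

theorem IsPos.coeff_pos {z : PuiseuxSeries} {μ : ℝ} (hpos : z.IsPos) (hz : z.HasVal μ) :
    0 < z.coeff μ := by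
  obtain ⟨α, hα, h⟩ := hpos
  rwa [hz.unique hα]

theorem eventually_eval_pos {z : PuiseuxSeries} {μ : ℝ} (hpos : z.IsPos) (hz : z.HasVal μ) :
    ∀ᶠ t in atTop, 0 < z.eval t := by
  filter_upwards [(tendsto_eval_div_rpow hz).eventually_const_lt (hpos.coeff_pos hz),
    eventually_gt_atTop 0] with t h ht
  exact (div_pos_iff_of_pos_right (Real.rpow_pos_of_pos ht _)).1 h

end PuiseuxSeries

theorem tendsto_logb_of_tendsto {g : ℝ → ℝ} {a : ℝ} (ha : a ≠ 0) (hg : Tendsto g atTop (𝓝 a)) :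
    Tendsto (fun t => Real.logb t (g t)) atTop (𝓝 0) := by
  have h := (hg.log ha).mul (tendsto_inv_atTop_zero.comp Real.tendsto_log_atTop)
  rw [mul_zero] at h
  exact h

theorem PuiseuxSeries.tendsto_logb_eval {z : PuiseuxSeries} {μ : ℝ} (hpos : z.IsPos)
    (hz : z.HasVal μ) : Tendsto (fun t => Real.logb t (z.eval t)) atTop (𝓝 μ) := by
  have h := (tendsto_logb_of_tendsto (hpos.coeff_pos hz).ne'
    (tendsto_eval_div_rpow hz)).add_const μ
  rw [zero_add] at h
  refine h.congr' ?_
  filter_upwards [eventually_gt_atTop 1, eventually_eval_pos hpos hz] with t ht hz0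
  have ht0 : 0 < t := by linarith
  rw [Real.logb_div hz0.ne' (Real.rpow_pos_of_pos ht0 _).ne', Real.logb_rpow ht0 ht.ne']
  ring

theorem logb_min {t a b : ℝ} (ht : 1 < t) (ha : 0 < a) (hb : 0 < b) :
    Real.logb t (min a b) = min (Real.logb t a) (Real.logb t b) := by
  rcases le_total a b with h | h
  · rw [min_eq_left h, min_eq_left (Real.logb_le_logb_of_le ht ha h)]
  · rw [min_eq_right h, min_eq_right (Real.logb_le_logb_of_le ht hb h)]

theorem logb_max {t a b : ℝ} (ht : 1 < t) (ha : 0 < a) (hb : 0 < b) :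
    Real.logb t (max a b) = max (Real.logb t a) (Real.logb t b) := by
  rcases le_total a b with h | h
  · rw [max_eq_right h, max_eq_right (Real.logb_le_logb_of_le ht ha h)]
  · rw [max_eq_left h, max_eq_left (Real.logb_le_logb_of_le ht hb h)]

/-- Functions which agree up to constant factors have the same limit on the `log_t` scale. -/
theorem tendsto_logb_of_le_of_le {f g : ℝ → ℝ} {a b l : ℝ} (ha : 0 < a) (hb : 0 < b)
    (hg0 : ∀ᶠ t in atTop, 0 < g t) (hfg : ∀ᶠ t in atTop, a * g t ≤ f t ∧ f t ≤ b * g t)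
    (hg : Tendsto (fun t => Real.logb t (g t)) atTop (𝓝 l)) :
    Tendsto (fun t => Real.logb t (f t)) atTop (𝓝 l) := by
  have h1 := (tendsto_logb_of_tendsto ha.ne' tendsto_const_nhds).add hg
  have h2 := (tendsto_logb_of_tendsto hb.ne' tendsto_const_nhds).add hg
  rw [zero_add] at h1 h2
  refine tendsto_of_tendsto_of_tendsto_of_le_of_le' h1 h2 ?_ ?_
  · filter_upwards [hg0, hfg, eventually_gt_atTop 1] with t hg0 hfg ht
    rw [← Real.logb_mul ha.ne' hg0.ne']
    exact Real.logb_le_logb_of_le ht (mul_pos ha hg0) hfg.1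
  · filter_upwards [hg0, hfg, eventually_gt_atTop 1] with t hg0 hfg ht
    rw [← Real.logb_mul hb.ne' hg0.ne']
    exact Real.logb_le_logb_of_le ht ((mul_pos ha hg0).trans_le hfg.1) hfg.2

/-! ### The constraints of the linear program -/

section Program

/-- The vector whose coordinates of (zero-based) indices `2 j` and `2 j + 1` are the components
of `p j`. -/
def interleave (r : ℕ) (p : ℕ → ℝ × ℝ) (k : Fin (2 * r)) : ℝ :=
  if k.val % 2 = 0 then (p (k.val / 2)).1 else (p (k.val / 2)).2

theorem interleave_even {r : ℕ} (p : ℕ → ℝ × ℝ) {j : ℕ} (h : 2 * j < 2 * r) :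
    interleave r p ⟨2 * j, h⟩ = (p j).1 := by
  simp [interleave]

theorem interleave_odd {r : ℕ} (p : ℕ → ℝ × ℝ) {j : ℕ} (h : 2 * j + 1 < 2 * r) :
    interleave r p ⟨2 * j + 1, h⟩ = (p j).2 := by
  have h1 : (2 * j + 1) % 2 = 1 := by omega
  have h2 : (2 * j + 1) / 2 = j := by omega
  simp [interleave, h1, h2]

theorem forall_fin_two_mul {r : ℕ} {Q : Fin (2 * r) → Prop}
    (h : ∀ (j : ℕ) (hj : j < r), Q ⟨2 * j, by omega⟩ ∧ Q ⟨2 * j + 1, by omega⟩) (k : Fin (2 * r)) :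
    Q k := by
  obtain ⟨k, hk⟩ := k
  obtain ⟨j, hj | hj⟩ := Nat.even_or_odd' k
  · subst hj
    exact (h j (by omega)).1
  · subst hj
    exact (h j (by omega)).2

/-- The rows of the constraint matrix at `t`. -/
noncomputable def lwRow (r : ℕ) (t : ℝ) (i : LWIneq r) (k : Fin (2 * r)) : ℝ :=
  (lwCoeff r i (k.val + 1)).eval t

theorem lwProgram_polyhedron (r : ℕ) (t : ℝ) :
    (lwProgram r).polyhedron t = {x | ∀ i, lwRow r t i ⬝ᵥ x ≤ (lwRhs r i).eval t} := rfl

variable {r : ℕ} {t : ℝ} (x : Fin (2 * r) → ℝ)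

theorem lwRow_dotProduct_top_fst (hr : 1 ≤ r) :
    lwRow r t (.inl 0) ⬝ᵥ x = x ⟨2 * 0, by omega⟩ := by
  have h : lwRow r t (.inl 0) = Pi.single ⟨2 * 0, by omega⟩ 1 := by
    ext k
    simp only [lwRow, lwCoeff, Pi.single_apply, Fin.ext_iff]
    split_ifs <;> first | omega | simp [PuiseuxSeries.eval_monomial]
  rw [h, single_one_dotProduct]

theorem lwRow_dotProduct_top_snd (hr : 1 ≤ r) :
    lwRow r t (.inl 1) ⬝ᵥ x = x ⟨2 * 0 + 1, by omega⟩ := by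
  have h : lwRow r t (.inl 1) = Pi.single ⟨2 * 0 + 1, by omega⟩ 1 := by
    ext k
    simp only [lwRow, lwCoeff, Pi.single_apply, Fin.ext_iff]
    split_ifs <;> first | omega | simp [PuiseuxSeries.eval_monomial]
  rw [h, single_one_dotProduct]

theorem lwRow_dotProduct_min_fst (i : Fin (r - 1)) :
    lwRow r t (.inr (.inl (i, 0))) ⬝ᵥ x
      = x ⟨2 * (i + 1), by omega⟩ - t * x ⟨2 * i, by omega⟩ := by
  have h : lwRow r t (.inr (.inl (i, 0)))
      = Pi.single ⟨2 * (i + 1), by omega⟩ 1 - t • Pi.single ⟨2 * i, by omega⟩ 1 := by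
    ext k
    simp only [lwRow, lwCoeff, Pi.sub_apply, Pi.smul_apply, Pi.single_apply, Fin.ext_iff]
    split_ifs <;> first | omega | simp [PuiseuxSeries.eval_monomial]
  rw [h, sub_dotProduct, smul_dotProduct, single_one_dotProduct, single_one_dotProduct,
    smul_eq_mul]

theorem lwRow_dotProduct_min_snd (i : Fin (r - 1)) :
    lwRow r t (.inr (.inl (i, 1))) ⬝ᵥ x
      = x ⟨2 * (i + 1), by omega⟩ - t * x ⟨2 * i + 1, by omega⟩ := by
  have h : lwRow r t (.inr (.inl (i, 1)))
      = Pi.single ⟨2 * (i + 1), by omega⟩ 1 - t • Pi.single ⟨2 * i + 1, by omega⟩ 1 := by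
    ext k
    simp only [lwRow, lwCoeff, Pi.sub_apply, Pi.smul_apply, Pi.single_apply, Fin.ext_iff]
    split_ifs <;> first | omega | simp [PuiseuxSeries.eval_monomial]
  rw [h, sub_dotProduct, smul_dotProduct, single_one_dotProduct, single_one_dotProduct,
    smul_eq_mul]

theorem lwRow_dotProduct_max (i : Fin (r - 1)) :
    lwRow r t (.inr (.inl (i, 2))) ⬝ᵥ x
      = x ⟨2 * (i + 1) + 1, by omega⟩ - t ^ (1 - 1 / 2 ^ (i.val + 1) : ℝ)
          * (x ⟨2 * i, by omega⟩ + x ⟨2 * i + 1, by omega⟩) := by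
  have h : lwRow r t (.inr (.inl (i, 2)))
      = Pi.single ⟨2 * (i + 1) + 1, by omega⟩ 1 - t ^ (1 - 1 / 2 ^ (i.val + 1) : ℝ) •
          (Pi.single ⟨2 * i, by omega⟩ 1 + Pi.single ⟨2 * i + 1, by omega⟩ 1) := by
    ext k
    simp only [lwRow, lwCoeff, Pi.sub_apply, Pi.smul_apply, Pi.add_apply, Pi.single_apply,
      Fin.ext_iff]
    split_ifs <;> first | omega | simp [PuiseuxSeries.eval_monomial]
  rw [h, sub_dotProduct, smul_dotProduct, add_dotProduct, single_one_dotProduct,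
    single_one_dotProduct, single_one_dotProduct, smul_eq_mul]

theorem lwRow_dotProduct_nonneg_fst (hr : 1 ≤ r) :
    lwRow r t (.inr (.inr 0)) ⬝ᵥ x = -x ⟨2 * (r - 1), by omega⟩ := by
  have h : lwRow r t (.inr (.inr 0)) = -Pi.single ⟨2 * (r - 1), by omega⟩ 1 := by
    ext k
    simp only [lwRow, lwCoeff, Pi.neg_apply, Pi.single_apply, Fin.ext_iff]
    split_ifs <;> first | omega | simp [PuiseuxSeries.eval_monomial]
  rw [h, neg_dotProduct, single_one_dotProduct]

theorem lwRow_dotProduct_nonneg_snd (hr : 1 ≤ r) :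
    lwRow r t (.inr (.inr 1)) ⬝ᵥ x = -x ⟨2 * (r - 1) + 1, by omega⟩ := by
  have h : lwRow r t (.inr (.inr 1)) = -Pi.single ⟨2 * (r - 1) + 1, by omega⟩ 1 := by
    ext k
    simp only [lwRow, lwCoeff, Pi.neg_apply, Pi.single_apply, Fin.ext_iff]
    split_ifs <;> first | omega | simp [PuiseuxSeries.eval_monomial]
  rw [h, neg_dotProduct, single_one_dotProduct]

variable {x}

theorem le_of_mem_lwProgram (hr : 1 ≤ r) (hx : x ∈ (lwProgram r).polyhedron t) :
    x ⟨2 * 0, by omega⟩ ≤ t ^ 2 ∧ x ⟨2 * 0 + 1, by omega⟩ ≤ t := by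
  rw [lwProgram_polyhedron] at hx
  have h0 := hx (.inl 0)
  have h1 := hx (.inl 1)
  rw [lwRow_dotProduct_top_fst x hr, lwRhs, PuiseuxSeries.eval_monomial, one_mul] at h0
  rw [lwRow_dotProduct_top_snd x hr, lwRhs, PuiseuxSeries.eval_monomial, one_mul,
    Real.rpow_one] at h1
  exact ⟨by exact_mod_cast h0, h1⟩

theorem le_succ_of_mem_lwProgram (hx : x ∈ (lwProgram r).polyhedron t) {j : ℕ} (hj : j + 1 < r) :
    x ⟨2 * (j + 1), by omega⟩ ≤ t * x ⟨2 * j, by omega⟩ ∧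
    x ⟨2 * (j + 1), by omega⟩ ≤ t * x ⟨2 * j + 1, by omega⟩ ∧
    x ⟨2 * (j + 1) + 1, by omega⟩ ≤ t ^ (1 - 1 / 2 ^ (j + 1) : ℝ)
      * (x ⟨2 * j, by omega⟩ + x ⟨2 * j + 1, by omega⟩) := by
  rw [lwProgram_polyhedron] at hx
  have h0 := hx (.inr (.inl (⟨j, by omega⟩, 0)))
  have h1 := hx (.inr (.inl (⟨j, by omega⟩, 1)))
  have h2 := hx (.inr (.inl (⟨j, by omega⟩, 2)))
  rw [lwRow_dotProduct_min_fst, lwRhs, PuiseuxSeries.eval_monomial, zero_mul] at h0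
  rw [lwRow_dotProduct_min_snd, lwRhs, PuiseuxSeries.eval_monomial, zero_mul] at h1
  rw [lwRow_dotProduct_max, lwRhs, PuiseuxSeries.eval_monomial, zero_mul] at h2
  exact ⟨sub_nonpos.1 h0, sub_nonpos.1 h1, sub_nonpos.1 h2⟩

theorem nonneg_last_of_mem_lwProgram (hr : 1 ≤ r) (hx : x ∈ (lwProgram r).polyhedron t) :
    0 ≤ x ⟨2 * (r - 1), by omega⟩ ∧ 0 ≤ x ⟨2 * (r - 1) + 1, by omega⟩ := by
  rw [lwProgram_polyhedron] at hx
  have h0 := hx (.inr (.inr 0))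
  have h1 := hx (.inr (.inr 1))
  rw [lwRow_dotProduct_nonneg_fst x hr, lwRhs, PuiseuxSeries.eval_monomial, zero_mul] at h0
  rw [lwRow_dotProduct_nonneg_snd x hr, lwRhs, PuiseuxSeries.eval_monomial, zero_mul] at h1
  exact ⟨neg_nonpos.1 h0, neg_nonpos.1 h1⟩

/-- Only the last pair is constrained to be nonnegative. Descending induction applies, because
`x_{2j+1}` is at most `t` times each coordinate of the preceding pair. -/
theorem nonneg_of_mem_lwProgram (hr : 1 ≤ r) (ht : 0 < t)
    (hx : x ∈ (lwProgram r).polyhedron t) (k : Fin (2 * r)) : 0 ≤ x k := by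
  have h : ∀ d j : ℕ, (hj : j + d + 1 = r) →
      0 ≤ x ⟨2 * j, by omega⟩ ∧ 0 ≤ x ⟨2 * j + 1, by omega⟩ := by
    intro d
    induction d with
    | zero =>
      intro j hj
      obtain rfl : j = r - 1 := by omega
      exact nonneg_last_of_mem_lwProgram hr hx
    | succ d ih =>
      intro j hj
      have h1 := ih (j + 1) (by omega)
      obtain ⟨h2, h3, -⟩ := le_succ_of_mem_lwProgram hx (j := j) (by omega)
      exact ⟨nonneg_of_mul_nonneg_right (h1.1.trans h2) ht,
        nonneg_of_mul_nonneg_right (h1.1.trans h3) ht⟩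
  exact forall_fin_two_mul (Q := fun k => 0 ≤ x k) (fun j hj => h (r - 1 - j) j (by omega)) k

theorem zero_mem_lwProgram (ht : 0 ≤ t) : (0 : Fin (2 * r) → ℝ) ∈ (lwProgram r).polyhedron t := by
  rw [lwProgram_polyhedron]
  intro i
  rw [dotProduct_zero]
  rcases i with i | i
  · fin_cases i <;> simp [lwRhs, PuiseuxSeries.eval_monomial] <;> positivity
  · simp [lwRhs, PuiseuxSeries.eval_monomial]

/-! ### The explicit extremal point -/

/-- A point which is feasible up to constant factors and, up to constant factors, the greatest
feasible point of objective value at most `m`. -/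
noncomputable def lwWitness (t m : ℝ) : ℕ → ℝ × ℝ
  -- The bounds `m` and `t m` express that the costs `x_1` and `t⁻¹ x_2` are each at most `m`. The
  -- factors 1/2, here and below, make every constraint strict.
  | 0 => (min (t ^ 2) m / 2, min t (t * m) / 2)
  | j + 1 => (t * min (lwWitness t m j).1 (lwWitness t m j).2 / 2,
      t ^ (1 - 1 / 2 ^ (j + 1) : ℝ) * max (lwWitness t m j).1 (lwWitness t m j).2 / 2)

theorem lwWitness_pos {m : ℝ} (ht : 0 < t) (hm : 0 < m) (j : ℕ) :
    0 < (lwWitness t m j).1 ∧ 0 < (lwWitness t m j).2 := by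
  induction j with
  | zero =>
    exact ⟨half_pos (lt_min (by positivity) hm), half_pos (lt_min ht (by positivity))⟩
  | succ j ih =>
    exact ⟨half_pos (mul_pos ht (lt_min ih.1 ih.2)),
      half_pos (mul_pos (Real.rpow_pos_of_pos ht _) (lt_max_of_lt_left ih.1))⟩

theorem lwWitness_strictly_feasible (hr : 1 ≤ r) {m : ℝ} (ht : 0 < t) (hm : 0 < m)
    (i : LWIneq r) : lwRow r t i ⬝ᵥ interleave r (lwWitness t m) < (lwRhs r i).eval t := by
  have hw := lwWitness_pos ht hm
  match i with
  | .inl 0 =>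
    rw [lwRow_dotProduct_top_fst _ hr, lwRhs, PuiseuxSeries.eval_monomial, one_mul,
      interleave_even, lwWitness]
    have h := min_le_left (t ^ 2) m
    have h2 : 0 < t ^ 2 := by positivity
    have h3 : t ^ (2 : ℝ) = t ^ 2 := by norm_cast
    rw [h3]
    linarith
  | .inl 1 =>
    rw [lwRow_dotProduct_top_snd _ hr, lwRhs, PuiseuxSeries.eval_monomial, one_mul,
      interleave_odd, lwWitness, Real.rpow_one]
    have h := min_le_left t (t * m)
    linarith
  | .inr (.inl (i, 0)) =>
    rw [lwRow_dotProduct_min_fst, lwRhs, PuiseuxSeries.eval_monomial, zero_mul,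
      interleave_even, interleave_even, lwWitness]
    have h := mul_le_mul_of_nonneg_left
      (min_le_left (lwWitness t m i).1 (lwWitness t m i).2) ht.le
    have h2 := mul_pos ht (hw i).1
    linarith
  | .inr (.inl (i, 1)) =>
    rw [lwRow_dotProduct_min_snd, lwRhs, PuiseuxSeries.eval_monomial, zero_mul,
      interleave_even, interleave_odd, lwWitness]
    have h := mul_le_mul_of_nonneg_left
      (min_le_right (lwWitness t m i).1 (lwWitness t m i).2) ht.le
    have h2 := mul_pos ht (hw i).2
    linarith
  | .inr (.inl (i, 2)) =>
    rw [lwRow_dotProduct_max, lwRhs, PuiseuxSeries.eval_monomial, zero_mul,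
      interleave_odd, interleave_odd, interleave_even, lwWitness]
    have ht' := Real.rpow_pos_of_pos ht (1 - 1 / 2 ^ (i.val + 1))
    have h := mul_le_mul_of_nonneg_left (max_le_add_of_nonneg (hw i).1.le (hw i).2.le) ht'.le
    have h2 := mul_pos ht' (add_pos (hw i).1 (hw i).2)
    linarith
  | .inr (.inr 0) =>
    rw [lwRow_dotProduct_nonneg_fst _ hr, lwRhs, PuiseuxSeries.eval_monomial, zero_mul,
      interleave_even]
    exact neg_lt_zero.2 (hw _).1
  | .inr (.inr 1) =>
    rw [lwRow_dotProduct_nonneg_snd _ hr, lwRhs, PuiseuxSeries.eval_monomial, zero_mul,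
      interleave_odd]
    exact neg_lt_zero.2 (hw _).2

theorem interleave_lwWitness_mem (hr : 1 ≤ r) {m : ℝ} (ht : 0 < t) (hm : 0 < m) :
    interleave r (lwWitness t m) ∈ (lwProgram r).polyhedron t :=
  fun i => (lwWitness_strictly_feasible hr ht hm i).le

/-- Feasible points are bounded by the witness, up to a constant factor. -/
theorem le_lwWitness_of_mem_lwProgram (hr : 1 ≤ r) {m K : ℝ} (ht : 0 < t) (hK : 1 ≤ K)
    (hx : x ∈ (lwProgram r).polyhedron t) (h0 : x ⟨2 * 0, by omega⟩ ≤ K * m)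
    (h1 : x ⟨2 * 0 + 1, by omega⟩ ≤ K * (t * m)) (j : ℕ) (hj : j < r) :
    x ⟨2 * j, by omega⟩ ≤ 2 * K * 4 ^ j * (lwWitness t m j).1 ∧
    x ⟨2 * j + 1, by omega⟩ ≤ 2 * K * 4 ^ j * (lwWitness t m j).2 := by
  have hK0 : 0 < K := by linarith
  have hn := nonneg_of_mem_lwProgram hr ht hx
  induction j with
  | zero =>
    obtain ⟨h2, h3⟩ := le_of_mem_lwProgram hr hx
    have h4 : t ^ 2 ≤ K * t ^ 2 := le_mul_of_one_le_left (by positivity) hK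
    have h5 : t ≤ K * t := le_mul_of_one_le_left ht.le hK
    have h6 := le_min (h2.trans h4) h0
    have h7 := le_min (h3.trans h5) h1
    rw [← mul_min_of_nonneg _ _ hK0.le] at h6 h7
    simp only [lwWitness, pow_zero, mul_one]
    constructor <;> linarith
  | succ j ih =>
    obtain ⟨ih1, ih2⟩ := ih (by omega)
    obtain ⟨h2, h3, h4⟩ := le_succ_of_mem_lwProgram hx hj
    set a := (lwWitness t m j).1
    set b := (lwWitness t m j).2
    have hC : 0 < 2 * K * 4 ^ j := by positivity
    set C := 2 * K * 4 ^ j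
    -- One factor 2 compensates the halving in `lwWitness`, the other the inequality `a + b ≤ 2 max
    -- a b`.
    have hCs : 2 * K * 4 ^ (j + 1) = 4 * C := by simp only [C]; ring
    rw [hCs]
    simp only [lwWitness]
    constructor
    · have h5 : x ⟨2 * (j + 1), by omega⟩ ≤ t * (C * min a b) := by
        rw [mul_min_of_nonneg _ _ hC.le, mul_min_of_nonneg _ _ ht.le]
        exact le_min (h2.trans (mul_le_mul_of_nonneg_left ih1 ht.le))
          (h3.trans (mul_le_mul_of_nonneg_left ih2 ht.le))
      have h6 : 0 ≤ t * (C * min a b) := (hn _).trans h5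
      change _ ≤ 4 * C * (t * min a b / 2)
      linarith
    · have ht' := (Real.rpow_pos_of_pos ht (1 - 1 / 2 ^ (j + 1))).le
      set s := t ^ (1 - 1 / 2 ^ (j + 1) : ℝ)
      have h5 := ih1.trans (mul_le_mul_of_nonneg_left (le_max_left a b) hC.le)
      have h6 := ih2.trans (mul_le_mul_of_nonneg_left (le_max_right a b) hC.le)
      have h7 := h4.trans (mul_le_mul_of_nonneg_left (add_le_add h5 h6) ht')
      change _ ≤ 4 * C * (s * max a b / 2)
      linarith

theorem isCompact_lwProgram (hr : 1 ≤ r) (ht : 1 ≤ t) :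
    IsCompact ((lwProgram r).polyhedron t) := by
  have ht0 : 0 < t := by linarith
  refine Metric.isCompact_of_isClosed_isBounded ?_ ?_
  · rw [lwProgram_polyhedron]
    exact isClosed_setOf_forall_dotProduct_le _ _
  -- With `m = t ^ 2` and `K = 1` the two budget conditions follow from `x_1 ≤ t ^ 2` and `x_2 ≤ t`,
  -- so every feasible point is bounded by this witness.
  · refine (Metric.isBounded_Icc (0 : Fin (2 * r) → ℝ)
      (interleave r fun j => (2 * 1 * 4 ^ j : ℝ) • lwWitness t (t ^ 2) j)).subset fun x hx => ?_
    refine ⟨nonneg_of_mem_lwProgram hr ht0 hx, forall_fin_two_mul fun j hj => ?_⟩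
    rw [interleave_even, interleave_odd]
    obtain ⟨h0, h1⟩ := le_of_mem_lwProgram hr hx
    refine le_lwWitness_of_mem_lwProgram hr (m := t ^ 2) ht0 le_rfl hx (by linarith) ?_ j hj
    have : t * 1 ≤ t * t ^ 2 := mul_le_mul_of_nonneg_left (one_le_pow₀ ht) ht0.le
    linarith

theorem convex_lwProgram : Convex ℝ ((lwProgram r).polyhedron t) :=
  convex_setOf_forall_dotProduct_le _ _

theorem lwProgram_cost_even {j : ℕ} (hj : j < r) : (lwProgram r).cost t ⟨2 * j, by omega⟩
    = if j = 0 then 1 else t ^ (-((j : ℝ) + 1)) := by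
  have h : (2 * j + 1 - 1) / 2 = j := by omega
  simp only [PuiseuxLP.cost, lwProgram, lwCost, h]
  split_ifs <;> first | omega | simp [PuiseuxSeries.eval_monomial]

theorem lwProgram_cost_odd {j : ℕ} (hj : j < r) : (lwProgram r).cost t ⟨2 * j + 1, by omega⟩
    = t ^ (-((j : ℝ) + 1)) := by
  have h : (2 * j + 1 + 1 - 1) / 2 = j := by omega
  simp only [PuiseuxLP.cost, lwProgram, lwCost, h]
  split_ifs with h1 h2
  · omega
  · obtain rfl : j = 0 := by omega
    simp [PuiseuxSeries.eval_monomial]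
  · simp [PuiseuxSeries.eval_monomial]

theorem lwProgram_cost_nonneg (ht : 0 ≤ t) (k : Fin (2 * r)) : 0 ≤ (lwProgram r).cost t k := by
  revert k
  refine forall_fin_two_mul fun j hj => ?_
  rw [lwProgram_cost_even hj, lwProgram_cost_odd hj]
  have := Real.rpow_nonneg ht (-((j : ℝ) + 1))
  refine ⟨?_, this⟩
  split_ifs
  · exact zero_le_one
  · exact this

/-- Each level gains at most a factor `t`, which the cost weight `t ^ (-(j + 1))` offsets. Hence the
budget `m` restricts only the first pair, up to constants. -/
theorem lwWitness_le {m : ℝ} (ht : 1 ≤ t) (hm : 0 < m) (j : ℕ) :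
    (lwWitness t m j).1 ≤ m * t ^ (j + 1) ∧ (lwWitness t m j).2 ≤ m * t ^ (j + 1) := by
  have ht0 : 0 < t := by linarith
  induction j with
  | zero =>
    have h1 := min_le_right (t ^ 2) m
    have h2 := min_le_right t (t * m)
    have h3 : m ≤ m * t := le_mul_of_one_le_right hm.le ht
    simp only [lwWitness, zero_add, pow_one]
    constructor <;> linarith
  | succ j ih =>
    have hp : 0 < m * t ^ (j + 1) := by positivity
    have h1 : min (lwWitness t m j).1 (lwWitness t m j).2 ≤ m * t ^ (j + 1) :=
      (min_le_left _ _).trans ih.1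
    have h2 : max (lwWitness t m j).1 (lwWitness t m j).2 ≤ m * t ^ (j + 1) := max_le ih.1 ih.2
    have h3 : t ^ (1 - 1 / 2 ^ (j + 1) : ℝ) ≤ t := by
      conv_rhs => rw [← Real.rpow_one t]
      refine Real.rpow_le_rpow_of_exponent_le ht ?_
      have : (0 : ℝ) < 1 / 2 ^ (j + 1) := by positivity
      linarith
    have h4 := mul_le_mul_of_nonneg_left h1 ht0.le
    have h5 := mul_le_mul h3 h2 (le_max_of_le_left (lwWitness_pos ht0 hm j).1.le) ht0.le
    have h6 : m * t ^ (j + 1 + 1) = t * (m * t ^ (j + 1)) := by ring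
    have h7 : 0 < t * (m * t ^ (j + 1)) := by positivity
    simp only [lwWitness]
    rw [h6]
    constructor <;> linarith

theorem cost_dotProduct_lwWitness_le {m : ℝ} (ht : 1 ≤ t) (hm : 0 < m) :
    (lwProgram r).cost t ⬝ᵥ interleave r (lwWitness t m) ≤ (2 * r) * m := by
  have ht0 : 0 < t := by linarith
  have h : ∀ k, (lwProgram r).cost t k * interleave r (lwWitness t m) k ≤ m := by
    refine forall_fin_two_mul fun j hj => ?_
    rw [lwProgram_cost_even hj, lwProgram_cost_odd hj, interleave_even, interleave_odd]
    have hc : t ^ (-((j : ℝ) + 1)) = (t ^ (j + 1))⁻¹ := by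
      rw [Real.rpow_neg ht0.le]
      norm_cast
    obtain ⟨h1, h2⟩ := lwWitness_le ht hm j
    have hp : 0 < t ^ (j + 1) := by positivity
    rw [hc, inv_mul_le_iff₀ hp, mul_comm _ m]
    refine ⟨?_, h2⟩
    split_ifs with hj0
    · subst hj0
      have := min_le_right (t ^ 2) m
      simp only [lwWitness]
      linarith
    · rw [inv_mul_le_iff₀ hp, mul_comm _ m]
      exact h1
  calc _ ≤ ∑ _k : Fin (2 * r), m := Finset.sum_le_sum fun k _ => h k
    _ = (2 * r) * m := by simp

/-! ### Tropicalization of the central path -/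

/-- The tropical entropic central path, arranged in pairs of coordinates. -/
noncomputable def lwTropical (μ : ℝ) : ℕ → ℝ × ℝ
  | 0 => (min 2 μ, min 1 (1 + μ))
  | j + 1 => (1 + min (lwTropical μ j).1 (lwTropical μ j).2,
      (1 - 1 / 2 ^ (j + 1)) + max (lwTropical μ j).1 (lwTropical μ j).2)

theorem tendsto_logb_half {f : ℝ → ℝ} {l : ℝ} (hf : ∀ᶠ t in atTop, 0 < f t)
    (h : Tendsto (fun t => Real.logb t (f t)) atTop (𝓝 l)) :
    Tendsto (fun t => Real.logb t (f t / 2)) atTop (𝓝 l) :=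
  tendsto_logb_of_le_of_le (a := 1 / 2) (b := 1 / 2) (by norm_num) (by norm_num) hf
    (Eventually.of_forall fun t => ⟨by linarith, by linarith⟩) h

/-- For `t > 1`, `log_t` commutes with `min` and `max` and turns products into sums, while the
factors 1/2 vanish in the limit. -/
theorem tendsto_logb_lwWitness {m : ℝ → ℝ} {μ : ℝ} (hm : ∀ᶠ t in atTop, 0 < m t)
    (hμ : Tendsto (fun t => Real.logb t (m t)) atTop (𝓝 μ)) (j : ℕ) :
    Tendsto (fun t => Real.logb t (lwWitness t (m t) j).1) atTop (𝓝 (lwTropical μ j).1) ∧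
    Tendsto (fun t => Real.logb t (lwWitness t (m t) j).2) atTop (𝓝 (lwTropical μ j).2) := by
  have hw : ∀ j, ∀ᶠ t in atTop, 0 < (lwWitness t (m t) j).1 ∧ 0 < (lwWitness t (m t) j).2 := by
    intro j
    filter_upwards [hm, eventually_gt_atTop 0] with t h ht using lwWitness_pos ht h j
  induction j with
  | zero =>
    constructor
    · refine tendsto_logb_half ?_ ?_
      · filter_upwards [hm, eventually_gt_atTop 0] with t h ht using lt_min (by positivity) h
      · refine Tendsto.congr' ?_ (tendsto_const_nhds.min hμ)
        filter_upwards [hm, eventually_gt_atTop 1] with t h ht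
        have ht0 : 0 < t := by linarith
        rw [logb_min ht (by positivity) h, Real.logb_pow, Real.logb_self_eq_one ht]
        norm_num
    · refine tendsto_logb_half ?_ ?_
      · filter_upwards [hm, eventually_gt_atTop 0] with t h ht using lt_min ht (by positivity)
      · refine Tendsto.congr' ?_ (tendsto_const_nhds.min (hμ.const_add 1))
        filter_upwards [hm, eventually_gt_atTop 1] with t h ht
        have ht0 : 0 < t := by linarith
        rw [logb_min ht ht0 (by positivity), Real.logb_mul ht0.ne' h.ne',
          Real.logb_self_eq_one ht]
  | succ j ih =>
    constructor
    · refine tendsto_logb_half ?_ ?_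
      · filter_upwards [hw j, eventually_gt_atTop 0] with t h ht
        exact mul_pos ht (lt_min h.1 h.2)
      · refine Tendsto.congr' ?_ ((ih.1.min ih.2).const_add 1)
        filter_upwards [hw j, eventually_gt_atTop 1] with t h ht
        have ht0 : 0 < t := by linarith
        rw [Real.logb_mul ht0.ne' (lt_min h.1 h.2).ne', logb_min ht h.1 h.2,
          Real.logb_self_eq_one ht]
    · refine tendsto_logb_half ?_ ?_
      · filter_upwards [hw j, eventually_gt_atTop 0] with t h ht
        exact mul_pos (Real.rpow_pos_of_pos ht _) (lt_max_of_lt_left h.1)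
      · refine Tendsto.congr' ?_ ((ih.1.max ih.2).const_add (1 - 1 / 2 ^ (j + 1)))
        filter_upwards [hw j, eventually_gt_atTop 1] with t h ht
        have ht0 : 0 < t := by linarith
        rw [Real.logb_mul (Real.rpow_pos_of_pos ht0 _).ne' (lt_max_of_lt_left h.1).ne',
          logb_max ht h.1 h.2, Real.logb_rpow ht0 ht.ne']

/-- The point of parameter `m` of the entropic central path agrees with the witness up to constants
which do not depend on `t` and `m`. -/
theorem gibbsMean_lwProgram_bounds (hr : 1 ≤ r) {m : ℝ} (ht : 1 ≤ t) (hm : 0 < m) (j : ℕ)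
    (hj : j < r) :
    let y := gibbsMean ((lwProgram r).polyhedron t) (-m⁻¹ • (lwProgram r).cost t)
    let a := (2 ^ (2 * r + 1))⁻¹ * Real.exp (-(2 * r / 2))
    let b := 2 * 2 ^ (2 * r + 1) * 4 ^ j
    (a * (lwWitness t m j).1 ≤ y ⟨2 * j, by omega⟩ ∧
      y ⟨2 * j, by omega⟩ ≤ b * (lwWitness t m j).1) ∧
    (a * (lwWitness t m j).2 ≤ y ⟨2 * j + 1, by omega⟩ ∧
      y ⟨2 * j + 1, by omega⟩ ≤ b * (lwWitness t m j).2) := by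
  intro y a b
  have ht0 : 0 < t := by linarith
  have hP := isCompact_lwProgram hr ht
  have hstrict := lwWitness_strictly_feasible hr ht0 hm
  have hv : volume ((lwProgram r).polyhedron t) ≠ 0 :=
    volume_setOf_forall_dotProduct_le_ne_zero hstrict
  have hy : y ∈ (lwProgram r).polyhedron t :=
    interior_subset (gibbsMean_mem_interior hstrict hP _)
  have hnn := fun x (hx : x ∈ (lwProgram r).polyhedron t) => nonneg_of_mem_lwProgram hr ht0 hx
  have hc := lwProgram_cost_nonneg (r := r) ht0.le
  have hθ : ∀ x ∈ (lwProgram r).polyhedron t, (-m⁻¹ • (lwProgram r).cost t) ⬝ᵥ x ≤ 0 := by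
    intro x hx
    rw [smul_dotProduct, smul_eq_mul, neg_mul, neg_nonpos]
    exact mul_nonneg (inv_pos.2 hm).le
      (Finset.sum_nonneg fun k _ => mul_nonneg (hc k) (hnn x hx k))
  have hK : -(2 * r : ℝ)
      ≤ (-m⁻¹ • (lwProgram r).cost t) ⬝ᵥ interleave r (lwWitness t m) := by
    rw [smul_dotProduct, smul_eq_mul, neg_mul, neg_le_neg_iff, inv_mul_le_iff₀ hm, mul_comm m]
    exact cost_dotProduct_lwWitness_le ht hm
  have hlow : ∀ k, a * interleave r (lwWitness t m) k ≤ y k := by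
    intro k
    have := le_gibbsMean hP hv convex_lwProgram hθ (interleave_lwWitness_mem hr ht0 hm) hK k
      fun x hx => hnn x hx k
    simpa only [Fintype.card_fin] using this
  have hup := neg_dotProduct_gibbsMean_le hP hv convex_lwProgram (zero_mem_lwProgram ht0.le)
    (-m⁻¹ • (lwProgram r).cost t)
  rw [smul_dotProduct, smul_eq_mul, neg_mul, neg_neg, inv_mul_le_iff₀ hm, Fintype.card_fin] at hup
  -- All cost terms are nonnegative, so each is bounded by the total. Only the first pair is used;
  -- the constraints propagate the bound to the others.
  have hcoord : ∀ k, (lwProgram r).cost t k * y k ≤ m * 2 ^ (2 * r + 1) := fun k =>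
    (Finset.single_le_sum (f := fun k => (lwProgram r).cost t k * y k)
      (fun k _ => mul_nonneg (hc k) (hnn y hy k)) (Finset.mem_univ k)).trans hup
  have h0 := hcoord ⟨2 * 0, by omega⟩
  have h1 := hcoord ⟨2 * 0 + 1, by omega⟩
  rw [lwProgram_cost_even (by omega), if_pos rfl, one_mul, mul_comm m] at h0
  rw [lwProgram_cost_odd (by omega), Nat.cast_zero, zero_add, Real.rpow_neg_one,
    inv_mul_le_iff₀ ht0] at h1
  have hub := le_lwWitness_of_mem_lwProgram hr ht0 (one_le_pow₀ one_le_two) hy h0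
    (by linarith) j hj
  refine ⟨⟨?_, hub.1⟩, ?_, hub.2⟩
  · rw [← interleave_even (lwWitness t m) (by omega : 2 * j < 2 * r)]
    exact hlow _
  · rw [← interleave_odd (lwWitness t m) (by omega : 2 * j + 1 < 2 * r)]
    exact hlow _

theorem isTropicalEntropicCentralPath_lwTropical (hr : 1 ≤ r) :
    (lwProgram r).IsTropicalEntropicCentralPath fun μ => interleave r (lwTropical μ) := by
  intro μ m hpos hval
  have hm := PuiseuxSeries.eventually_eval_pos hpos hval
  refine ⟨fun t => gibbsMean ((lwProgram r).polyhedron t)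
    (-(m.eval t)⁻¹ • (lwProgram r).cost t), ?_, ?_⟩
  · filter_upwards [hm, eventually_ge_atTop 1] with t hm ht
    have hP := isCompact_lwProgram hr ht
    have hstrict := lwWitness_strictly_feasible hr (zero_lt_one.trans_le ht) hm
    exact isEntropicCentralPoint_gibbsMean hP
      (volume_setOf_forall_dotProduct_le_ne_zero hstrict) _ hm
      (gibbsMean_mem_interior hstrict hP _)
  · refine tendsto_pi_nhds.2 (forall_fin_two_mul fun j hj => ?_)
    simp only [interleave_even (lwTropical μ), interleave_odd (lwTropical μ)]
    have hb : ∀ᶠ t in atTop, 1 ≤ t ∧ 0 < m.eval t := (eventually_ge_atTop 1).and hm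
    have hw := tendsto_logb_lwWitness hm (PuiseuxSeries.tendsto_logb_eval hpos hval) j
    constructor
    · refine tendsto_logb_of_le_of_le (by positivity) (by positivity) ?_
        (hb.mono fun t h => (gibbsMean_lwProgram_bounds hr h.1 h.2 j hj).1) hw.1
      exact hb.mono fun t h => (lwWitness_pos (by linarith [h.1]) h.2 j).1
    · refine tendsto_logb_of_le_of_le (by positivity) (by positivity) ?_
        (hb.mono fun t h => (gibbsMean_lwProgram_bounds hr h.1 h.2 j hj).2) hw.2
      exact hb.mono fun t h => (lwWitness_pos (by linarith [h.1]) h.2 j).2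

end Program

/-! ### Counting the linear pieces -/

section LinearPieces

/-- The folding step: `min - max` is minus the absolute difference, and the exponents `1` and `1 - 1
/ 2 ^ (n + 1)` supply the shift. -/
theorem lwTropical_succ_sub (μ : ℝ) (n : ℕ) :
    (lwTropical μ (n + 1)).1 - (lwTropical μ (n + 1)).2
      = 1 / 2 ^ (n + 1) - |(lwTropical μ n).1 - (lwTropical μ n).2| := by
  rw [← max_sub_min_eq_abs']
  simp only [lwTropical]
  ring

/-- Dyadic nesting: cell `k` of level `n + 1` is a half of cell `k / 2` of level `n`, the left half
exactly when `k` is even. -/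
theorem half_cell {n k : ℕ} {μ : ℝ} (h1 : 2 * k ≤ 2 ^ (n + 1) * μ)
    (h2 : 2 ^ (n + 1) * μ ≤ 2 * k + 2) :
    (2 * (k / 2 : ℕ) : ℝ) ≤ 2 ^ n * μ ∧ 2 ^ n * μ ≤ 2 * (k / 2 : ℕ) + 2 := by
  rw [pow_succ] at h1 h2
  have h3 : ((k / 2 : ℕ) : ℝ) * 2 ≤ k := by exact_mod_cast Nat.div_mul_le_self k 2
  have h4 : (k : ℝ) + 1 ≤ 2 * (k / 2 : ℕ) + 2 := by
    have : k + 1 ≤ 2 * (k / 2) + 2 := by omega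
    exact_mod_cast this
  constructor <;> linarith

/-- On each cell of the subdivision of `[0, 2]` into `2 ^ n` equal intervals, the difference of the
two coordinates of the `n`-th pair is affine, with slopes alternating between `1` and `-1`. -/
theorem lwTropical_sub_eq (n k : ℕ) (hk : k < 2 ^ n) {μ : ℝ} (h1 : 2 * k ≤ 2 ^ n * μ)
    (h2 : 2 ^ n * μ ≤ 2 * k + 2) :
    (lwTropical μ n).1 - (lwTropical μ n).2 = (-1) ^ k * (μ - (2 * k + 1) / 2 ^ n) := by
  induction n generalizing k with
  | zero =>
    obtain rfl : k = 0 := by simpa using hk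
    simp only [Nat.cast_zero, pow_zero, one_mul, mul_zero, zero_add] at h1 h2
    simp only [lwTropical]
    rw [min_eq_right h2, min_eq_left (by linarith)]
    simp
  | succ n ih =>
    have hc := half_cell h1 h2
    rw [lwTropical_succ_sub, ih (k / 2) (by rw [pow_succ] at hk; omega) hc.1 hc.2, abs_mul,
      abs_pow, abs_neg, abs_one, one_pow, one_mul]
    have hp : (0 : ℝ) < 2 ^ n := by positivity
    have hs : μ - (2 * (k / 2 : ℕ) + 1) / 2 ^ n
        = (2 ^ n * μ - (2 * (k / 2 : ℕ) + 1)) / 2 ^ n := by field_simp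
    rw [pow_succ] at h1 h2
    rcases Nat.even_or_odd' k with ⟨l, rfl | rfl⟩
    -- On a left half, `μ` lies below the centre of the parent cell, so the folded difference has
    -- slope `1`; on a right half it has slope `-1`.
    · have hl : 2 * l / 2 = l := by omega
      rw [hl] at hs ⊢
      push_cast at h1 h2 ⊢
      rw [abs_of_nonpos (by rw [hs]; exact div_nonpos_of_nonpos_of_nonneg (by linarith) hp.le)]
      simp only [pow_mul, pow_succ]
      field_simp
      ring
    · have hl : (2 * l + 1) / 2 = l := by omega
      rw [hl] at hs ⊢
      push_cast at h1 h2 ⊢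
      rw [abs_of_nonneg (by rw [hs]; exact div_nonneg (by linarith) hp.le)]
      simp only [pow_succ, pow_mul, mul_neg, mul_one]
      field_simp
      ring

/-- The difference of pair `n` vanishes only at the centre of a level `n` cell, so it keeps its sign
on each half. There `min` and `max` each select a fixed coordinate, and the next pair is affine. -/
theorem lwTropical_affine (n k : ℕ) (hk : k < 2 ^ n) (j : ℕ) (hj : j ≤ n) :
    ∃ u v : ℝ × ℝ, ∀ μ : ℝ, 2 * k ≤ 2 ^ n * μ → 2 ^ n * μ ≤ 2 * k + 2 →
      lwTropical μ j = u + μ • v := by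
  induction n generalizing k j with
  | zero =>
    obtain rfl : k = 0 := by simpa using hk
    obtain rfl : j = 0 := by omega
    refine ⟨(0, 1), (1, 0), fun μ h1 h2 => ?_⟩
    simp only [Nat.cast_zero, pow_zero, one_mul, mul_zero, zero_add] at h1 h2
    simp only [lwTropical]
    rw [min_eq_right h2, min_eq_left (by linarith)]
    simp
  | succ n ih =>
    have hk2 : k / 2 < 2 ^ n := by rw [pow_succ] at hk; omega
    rcases Nat.lt_or_ge n j with hnj | hnj
    · obtain rfl : j = n + 1 := by omega
      obtain ⟨u, v, huv⟩ := ih (k / 2) hk2 n le_rfl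
      have hsign : (∀ μ : ℝ, 2 * k ≤ 2 ^ (n + 1) * μ → 2 ^ (n + 1) * μ ≤ 2 * k + 2 →
            (lwTropical μ n).1 ≤ (lwTropical μ n).2) ∨
          (∀ μ : ℝ, 2 * k ≤ 2 ^ (n + 1) * μ → 2 ^ (n + 1) * μ ≤ 2 * k + 2 →
            (lwTropical μ n).2 ≤ (lwTropical μ n).1) := by
        have hp : (0 : ℝ) < 2 ^ n := by positivity
        have hd : ∀ μ : ℝ, 2 * k ≤ 2 ^ (n + 1) * μ → 2 ^ (n + 1) * μ ≤ 2 * k + 2 →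
            (lwTropical μ n).1 - (lwTropical μ n).2
              = (-1) ^ (k / 2) * ((2 ^ n * μ - (2 * (k / 2 : ℕ) + 1)) / 2 ^ n) := by
          intro μ h1 h2
          have hc := half_cell h1 h2
          rw [lwTropical_sub_eq n (k / 2) hk2 hc.1 hc.2]
          field_simp
        have hs : (∀ μ : ℝ, 2 * k ≤ 2 ^ (n + 1) * μ → 2 ^ (n + 1) * μ ≤ 2 * k + 2 →
              (2 ^ n * μ - (2 * (k / 2 : ℕ) + 1)) / 2 ^ n ≤ 0) ∨
            (∀ μ : ℝ, 2 * k ≤ 2 ^ (n + 1) * μ → 2 ^ (n + 1) * μ ≤ 2 * k + 2 →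
              0 ≤ (2 ^ n * μ - (2 * (k / 2 : ℕ) + 1)) / 2 ^ n) := by
          rcases Nat.even_or_odd' k with ⟨l, rfl | rfl⟩
          · left
            intro μ h1 h2
            have hl : 2 * l / 2 = l := by omega
            rw [pow_succ] at h1 h2
            push_cast at h1 h2
            rw [hl]
            exact div_nonpos_of_nonpos_of_nonneg (by linarith) hp.le
          · right
            intro μ h1 h2
            have hl : (2 * l + 1) / 2 = l := by omega
            rw [pow_succ] at h1 h2
            push_cast at h1 h2
            rw [hl]
            exact div_nonneg (by linarith) hp.le
        -- The parity of the parent `k / 2` decides whether the two alternatives are exchanged.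
        rcases neg_one_pow_eq_or ℝ (k / 2) with he | he <;> rw [he] at hd
        · refine hs.imp (fun h μ h1 h2 => ?_) (fun h μ h1 h2 => ?_) <;>
            linarith [hd μ h1 h2, h μ h1 h2]
        · refine hs.symm.imp (fun h μ h1 h2 => ?_) (fun h μ h1 h2 => ?_) <;>
            linarith [hd μ h1 h2, h μ h1 h2]
      rcases hsign with h | h
      · refine ⟨(1 + u.1, 1 - 1 / 2 ^ (n + 1) + u.2), v, fun μ h1 h2 => ?_⟩
        have hc := half_cell h1 h2
        rw [lwTropical, min_eq_left (h μ h1 h2), max_eq_right (h μ h1 h2), huv μ hc.1 hc.2]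
        ext <;> simp <;> ring
      · refine ⟨(1 + u.2, 1 - 1 / 2 ^ (n + 1) + u.1), (v.2, v.1), fun μ h1 h2 => ?_⟩
        have hc := half_cell h1 h2
        rw [lwTropical, min_eq_right (h μ h1 h2), max_eq_left (h μ h1 h2), huv μ hc.1 hc.2]
        ext <;> simp <;> ring
    · obtain ⟨u, v, huv⟩ := ih (k / 2) hk2 j hnj
      exact ⟨u, v, fun μ h1 h2 => huv μ (half_cell h1 h2).1 (half_cell h1 h2).2⟩

theorem affineSubdivision_lwTropical (n : ℕ) :
    AffineSubdivision (fun μ => interleave (n + 1) (lwTropical μ)) 0 2 (2 ^ n) := by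
  have hp : (0 : ℝ) < 2 ^ n := by positivity
  refine ⟨fun i => 2 * (i.val : ℝ) / 2 ^ n, ?_, by simp, ?_, fun i => ?_⟩
  · intro i j hij
    have : (i.val : ℝ) < j.val := by exact_mod_cast hij
    simp only
    gcongr
  · simp only [Fin.val_last, Nat.cast_pow, Nat.cast_ofNat]
    field_simp
  · have h := fun j : ℕ => fun hj : j ≤ n => lwTropical_affine n i i.isLt j hj
    choose! u v huv using h
    refine ⟨interleave (n + 1) u, interleave (n + 1) v, fun s hs => ?_⟩
    simp only [Fin.val_castSucc, Fin.val_succ, Nat.cast_add, Nat.cast_one, Set.mem_Icc] at hs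
    rw [div_le_iff₀ hp, le_div_iff₀ hp] at hs
    refine funext (forall_fin_two_mul fun j hj => ?_)
    simp only [Pi.add_apply, Pi.smul_apply]
    rw [interleave_even, interleave_even, interleave_even, interleave_odd, interleave_odd,
      interleave_odd, huv j (by omega) s (by linarith [hs.1]) (by linarith [hs.2])]
    exact ⟨rfl, rfl⟩

/-- A kink of the tropical central path is a breakpoint of every affine subdivision. -/
theorem exists_eq_of_affineSubdivision_lwTropical (n : ℕ) {M : ℕ} {p : Fin (M + 1) → ℝ}
    (hp0 : p 0 = 0) (hpM : p (Fin.last M) = 2)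
    (hp : ∀ i : Fin M, ∃ u v : Fin (2 * (n + 1)) → ℝ,
      ∀ s ∈ Set.Icc (p i.castSucc) (p i.succ), interleave (n + 1) (lwTropical s) = u + s • v)
    (k : ℕ) (hk : k ≤ 2 ^ n) : ∃ i, p i = 2 * k / 2 ^ n := by
  have h2n : (0 : ℝ) < 2 ^ n := by positivity
  rcases Nat.eq_zero_or_pos k with rfl | hk0
  · exact ⟨0, by simp [hp0]⟩
  rcases hk.eq_or_lt with rfl | hk1
  · refine ⟨Fin.last M, ?_⟩
    rw [hpM]
    push_cast
    field_simp
  obtain ⟨l, rfl⟩ : ∃ l, k = l + 1 := ⟨k - 1, by omega⟩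
  set q : ℝ := 2 * (l + 1 : ℕ) / 2 ^ n with hq
  by_contra! hne
  have hq2 : q < 2 := by
    rw [hq, div_lt_iff₀ h2n]
    have : ((l + 1 : ℕ) : ℝ) < 2 ^ n := by exact_mod_cast hk1
    linarith
  -- Otherwise induction keeps every breakpoint below `q`, although the last one is `2 > q`.
  obtain ⟨i, hi1, hi2⟩ : ∃ i : Fin M, p i.castSucc < q ∧ q < p i.succ := by
    by_contra! hcon
    have hall : ∀ i, p i < q := by
      intro i
      induction i using Fin.induction with
      | zero => rw [hp0]; positivity
      | succ i ih => exact lt_of_le_of_ne (hcon i ih) (hne _)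
    linarith [hall (Fin.last M)]
  obtain ⟨u, v, huv⟩ := hp i
  -- This keeps `q ± δ` in the affine piece and in the two cells adjacent to `q`, whose width is `2
  -- / 2 ^ n`.
  set δ := min (min (q - p i.castSucc) (p i.succ - q)) (2 / 2 ^ n) with hδ
  have hδ0 : 0 < δ := lt_min (lt_min (sub_pos.2 hi1) (sub_pos.2 hi2)) (by positivity)
  have hδ1 : δ ≤ q - p i.castSucc := (min_le_left _ _).trans (min_le_left _ _)
  have hδ2 : δ ≤ p i.succ - q := (min_le_left _ _).trans (min_le_right _ _)
  have hδ3 : 2 ^ n * δ ≤ 2 := by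
    rw [mul_comm, ← le_div_iff₀ h2n]
    exact min_le_right _ _
  have hδ4 : 0 < 2 ^ n * δ := by positivity
  have haff : ∀ s ∈ Set.Icc (p i.castSucc) (p i.succ),
      (lwTropical s n).1 - (lwTropical s n).2
        = (u ⟨2 * n, by omega⟩ - u ⟨2 * n + 1, by omega⟩)
          + s * (v ⟨2 * n, by omega⟩ - v ⟨2 * n + 1, by omega⟩) := by
    intro s hs
    rw [← interleave_even (lwTropical s) (by omega : 2 * n < 2 * (n + 1)),
      ← interleave_odd (lwTropical s) (by omega : 2 * n + 1 < 2 * (n + 1)), huv s hs]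
    simp only [Pi.add_apply, Pi.smul_apply, smul_eq_mul]
    ring
  have e1 := haff (q - δ) ⟨by linarith, by linarith⟩
  have e2 := haff q ⟨by linarith, by linarith⟩
  have e3 := haff (q + δ) ⟨by linarith, by linarith⟩
  have hqn : 2 ^ n * q = 2 * (l + 1) := by
    rw [hq]
    push_cast
    field_simp
  rw [lwTropical_sub_eq n l (by omega) (by linarith) (by linarith)] at e1 e2
  rw [lwTropical_sub_eq n (l + 1) hk1 (by push_cast; linarith) (by push_cast; linarith)] at e3
  have hq' : q = (2 * l + 1) / 2 ^ n + 1 / 2 ^ n := by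
    rw [hq]
    push_cast
    ring
  have hq'' : (2 * ((l + 1 : ℕ) : ℝ) + 1) / 2 ^ n = q + 1 / 2 ^ n := by
    rw [hq]
    ring
  rw [hq'', pow_succ] at e3
  -- The second difference at `q` is `0` by affinity but `-2 (-1) ^ l δ` by the zigzag formula.
  have hfin : ((-1 : ℝ) ^ l) * δ = 0 := by
    set A := ((2 * l + 1 : ℝ)) / 2 ^ n
    set B := (1 : ℝ) / 2 ^ n
    have hA : A = q - B := by linarith
    rw [hA] at e1 e2
    linarith
  rcases neg_one_pow_eq_or ℝ l with h | h <;> rw [h] at hfin <;> linarith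

theorem hasLinearPieces_lwTropical (n : ℕ) :
    HasLinearPieces (fun μ => interleave (n + 1) (lwTropical μ)) 0 2 (2 ^ n) := by
  refine ⟨affineSubdivision_lwTropical n, ?_⟩
  rintro M ⟨p, -, hp0, hpM, hp⟩
  have h2n : (0 : ℝ) < 2 ^ n := by positivity
  -- The `2 ^ n + 1` cell endpoints are distinct values among the `M + 1` breakpoints, whence `2 ^ n
  -- ≤ M`.
  choose f hf using fun k : Fin (2 ^ n + 1) =>
    exists_eq_of_affineSubdivision_lwTropical n hp0 hpM hp k (by omega)
  have hinj : Function.Injective f := by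
    intro k l hkl
    have h : 2 * (k.val : ℝ) / 2 ^ n = 2 * (l.val : ℝ) / 2 ^ n := by rw [← hf k, ← hf l, hkl]
    rw [div_left_inj' h2n.ne'] at h
    have h' : (k.val : ℝ) = l.val := by linarith
    exact Fin.ext (by exact_mod_cast h')
  have := Fintype.card_le_of_injective f hinj
  simpa using this

end LinearPieces

theorem mainTheorem3 (r : ℕ) (hr : 1 ≤ r) :
    Fintype.card (LWIneq r) = 3 * r + 1 ∧
    ∃ x : ℝ → Fin (2 * r) → ℝ,
      (lwProgram r).IsTropicalEntropicCentralPath x ∧ HasLinearPieces x 0 2 (2 ^ (r - 1)) := by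
  obtain ⟨n, rfl⟩ : ∃ n, r = n + 1 := ⟨r - 1, by omega⟩
  refine ⟨?_, fun μ => interleave (n + 1) (lwTropical μ),
    isTropicalEntropicCentralPath_lwTropical hr, hasLinearPieces_lwTropical n⟩
  simp only [Fintype.card_sum, Fintype.card_prod, Fintype.card_fin]
  omega
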